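/- Let $d\ge 1$ and let $\mathcal C\subset\mathbb R^d$ be compact and regular, i.e. there are $\kappa,r_0>0$ such that $\mathrm{Leb}(\mathcal C\cap \bar B(x,r))\ge \kappa\,\mathrm{Leb}(\bar B(x,r))$ for all $x\in\mathcal C$ and $0<r\le r_0$. Let $f^*,\sigma^2$ be real functions that are Lipschitz on $\mathcal C$, and let $c_0>0$, $\mu_{\min}>0$, $0<a\le b$ and $\alpha\ge 0$. Then there is a constant $C>0$, depending only on $d,\mathcal C,f^*,\sigma^2,c_0,\mu_{\min},a,b,\alpha$, such that the following holds. Let $(X,Y)$ be a random couple in $\mathbb R^d\times\mathbb R$ such that - $f^*(x)=\mathbb E[Y\mid X=x]$ and $\sigma^2(x)=\mathbb E[(Y-f^*(X))^2\mid X=x]$ for almost every $x$ with respect to the law of $X$; - (strong density) $X\in\mathcal C$ almost surely and $X$ has a density $\mu$ with respect to Lebesgue measure with $\mu_{\min}\le\mu(x)\le\mu_{\max}$ for all $x\in\mathcal C$, for some finite $\mu_{\max}$; - (uniformly sub-exponential noise) for almost every $x$ with respect to the law of $X$, $\mathbb E[\exp(\lambda(Y-f^*(X)))\mid X=x]\le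 \exp(c_0^2\lambda^2)$ for all $|\lambda|\le 1/c_0$. (For a suitable $c_0$ this holds in particular if $Y$ is bounded, or if $Y=f^*(X)+\sigma(X)\xi$ with $\xi$ standard normal and independent of $X$.) Let $n\ge 2$, let $k_n\le n$ be an integer with $a\,n^{2/(d+2)}\le k_n\le b\,n^{2/(d+2)}$, and let $(X_1,Y_1),\dots,(X_n,Y_n)$ be independent copies of $(X,Y)$. For $x\in\mathbb R^d$ let $(X_{(i,n)}(x),Y_{(i,n)}(x))_{1\le i\le n}$ be the data reordered by increasing Euclidean distance of the $X_i$ to $x$, ties being broken by the smaller index, and put $$\hat f(x)=\frac1{k_n}\sum_{i=1}^{k_n}Y_{(i,n)}(x),\qquad \hat\sigma^2(x)=\frac1{k_n}\sum_{i=1}^{k_n}\bigl(Y_{(i,n)}(x)-\hat f(X_{(i,n)}(x))\bigr)^2 .$$ Then $\sup_{x\in\mathcal C}|\hat\sigma^2(x)-\sigma^2(x)|$ is a random variable (measurable up to a null set) and $$\mathbb E\Bigl[\bigl(\sup_{x\in\mathcal C}|\hat\sigma^2(x)-\sigma^2(x)|\bigr)^{1+\alpha}\Bigr]\le C\,\log(n)^{\alpha+1}\,n^{-(\alpha+1)/(d+2)}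 .$$ -/

import Mathlib

open MeasureTheory ProbabilityTheory
open scoped ENNReal

noncomputable section

/-- A set `C ⊆ ℝ^d` is regular: for some `c₀, r₀ > 0`, every ball of radius at most `r₀` centred
in `C` has at least the proportion `c₀` of its Lebesgue measure inside `C`. -/
def IsRegularSet {d : ℕ} (C : Set (EuclideanSpace ℝ (Fin d))) : Prop :=
  ∃ c₀ : ℝ, 0 < c₀ ∧ ∃ r₀ : ℝ, 0 < r₀ ∧ ∀ x ∈ C, ∀ r : ℝ, 0 < r → r ≤ r₀ →
    ENNReal.ofReal c₀ * volume (Metric.closedBall x r) ≤ volume (C ∩ Metric.closedBall x r)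

/-- Strong density assumption with lower bound `μmin`: the law `ρ` is carried by `C` and has a
Lebesgue density which on `C` is at least `μmin` and at most some finite constant `μmax`. -/
def StrongDensity {d : ℕ} (ρ : Measure (EuclideanSpace ℝ (Fin d)))
    (C : Set (EuclideanSpace ℝ (Fin d))) (μmin : ℝ) : Prop :=
  ρ Cᶜ = 0 ∧
    ∃ (μ : EuclideanSpace ℝ (Fin d) → ℝ) (μmax : ℝ), Measurable μ ∧
      ρ = volume.withDensity (fun x => ENNReal.ofReal (μ x)) ∧
      ∀ x ∈ C, μmin ≤ μ x ∧ μ x ≤ μmax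

/-- `f` is a version of the regression function `x ↦ E[Y | X = x]` when `(X, Y)` has law `ν`;
`ν.condKernel x` is the conditional distribution of `Y` given `X = x`. -/
def IsRegressionFunction {d : ℕ} (ν : Measure (EuclideanSpace ℝ (Fin d) × ℝ)) [IsFiniteMeasure ν]
    (f : EuclideanSpace ℝ (Fin d) → ℝ) : Prop :=
  ∀ᵐ x ∂ν.fst, Integrable (fun y : ℝ => y) (ν.condKernel x) ∧ ∫ y, y ∂(ν.condKernel x) = f x

/-- `v` is a version of `x ↦ E[(Y - f(X))² | X = x]` when `(X, Y)` has law `ν`. -/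
def IsConditionalVariance {d : ℕ} (ν : Measure (EuclideanSpace ℝ (Fin d) × ℝ)) [IsFiniteMeasure ν]
    (f v : EuclideanSpace ℝ (Fin d) → ℝ) : Prop :=
  ∀ᵐ x ∂ν.fst, Integrable (fun y : ℝ => (y - f x) ^ 2) (ν.condKernel x) ∧
    ∫ y, (y - f x) ^ 2 ∂(ν.condKernel x) = v x

/-- Uniformly sub-exponential noise with constant `c₀`: for almost every `x`,
`E[exp (t (Y - f(X))) | X = x] ≤ exp (c₀² t²)` for all `|t| ≤ 1 / c₀`. -/
def UniformNoise {d : ℕ} (ν : Measure (EuclideanSpace ℝ (Fin d) × ℝ)) [IsFiniteMeasure ν]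
    (f : EuclideanSpace ℝ (Fin d) → ℝ) (c₀ : ℝ) : Prop :=
  ∀ᵐ x ∂ν.fst, ∀ t : ℝ, |t| ≤ 1 / c₀ →
    ∫⁻ y, ENNReal.ofReal (Real.exp (t * (y - f x))) ∂(ν.condKernel x) ≤
      ENNReal.ofReal (Real.exp (c₀ ^ 2 * t ^ 2))

/-- The permutation that reorders the data `D = ((X_i, Y_i))_i` by increasing Euclidean distance of
`X_i` to `x`; ties are broken by the smaller index. -/
def neighborOrder {d n : ℕ} (D : Fin n → EuclideanSpace ℝ (Fin d) × ℝ)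
    (x : EuclideanSpace ℝ (Fin d)) : Equiv.Perm (Fin n) :=
  Tuple.sort fun j => ‖(D j).1 - x‖

/-- The `k` nearest neighbours estimator of the regression function: the mean of the `k` first
outputs in the order `neighborOrder D x`. -/
def knnRegression {d n : ℕ} (k : ℕ) (D : Fin n → EuclideanSpace ℝ (Fin d) × ℝ)
    (x : EuclideanSpace ℝ (Fin d)) : ℝ :=
  (1 / (k : ℝ)) * ∑ i ∈ Finset.univ.filter (fun i : Fin n => (i : ℕ) < k), (D (neighborOrder D x i)).2

/-- The residual-based `k` nearest neighbours estimator of the conditional variance. -/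
def knnVariance {d n : ℕ} (k : ℕ) (D : Fin n → EuclideanSpace ℝ (Fin d) × ℝ)
    (x : EuclideanSpace ℝ (Fin d)) : ℝ :=
  (1 / (k : ℝ)) * ∑ i ∈ Finset.univ.filter (fun i : Fin n => (i : ℕ) < k),
    ((D (neighborOrder D x i)).2 - knnRegression k D (D (neighborOrder D x i)).1) ^ 2

/-- The sup-norm error `sup_{x ∈ C} |σ̂²(x) - v(x)|`, with values in `[0, ∞]`. -/
def knnVarianceSupError {d n : ℕ} (k : ℕ) (C : Set (EuclideanSpace ℝ (Fin d)))
    (v : EuclideanSpace ℝ (Fin d) → ℝ) (D : Fin n → EuclideanSpace ℝ (Fin d) × ℝ) : ℝ≥0∞ :=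
  ⨆ x ∈ C, ENNReal.ofReal |knnVariance k D x - v x|

end

/-! Write e_i = Y_i − f(X_i) and η_i = f(X_i) − f̂(X_i). The residual at X_i is e_i + η_i. Expanding
its square bounds the error, uniformly over C, by three random quantities: the largest mean of e
over a nearest-neighbour set of a point of C, the largest such mean of e² − v, and the largest
neighbour distance R (`abs_knnVariance_sub_le`). Only values of f̂ at data points enter. These lie
in C almost surely, so a uniform bound for f̂ over C suffices, and reusing the sample does no harm.
Each of the three quantities, divided by log n · n^(-1/(d+2)), has bounded moments of every order.

Means. The neighbour sets depend on the X_i alone, and given these the noises are independent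
(`lintegral_pi_mul_prod_le`). At most (n+1)^(d+3) sets occur: after lifting X_i to (X_i, ‖X_i‖², i)
a neighbour set is cut out by a half-space, so Radon's theorem bounds the VC dimension and
Sauer–Shelah the number of sets. A union bound therefore costs a factor log n. Since e² need not
have exponential moments, exp t is replaced by 1 + t + t² at t = g/√k. This is nonnegative
everywhere and, for centred g with conditional second moment at most V, integrates to at most 1 +
V/k, so that k factors give at most e^V. When some |g| exceeds √k, the largest term dominates and a
high moment pays for it (`pow_abs_mean_le`). The means are thus of order log n / √k.

Radius. A ball of radius r centred in C has mass at least c r^d, so neighbour distances are of order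
(k/n)^(1/d), by a Chernoff bound averaged over centres (`exists_radius_event`). For k of order
n^(2/(d+2)), both k^(-1/2) and (k/n)^(1/d) are of order n^(-1/(d+2)). -/

/-! ### Nearest-neighbour sets and their number -/

/-- The set of the `k` indices that come first when the points `X i` are ordered by increasing
distance to `x`, ties being broken by the smaller index. -/
noncomputable def nearestSet {d n : ℕ} (k : ℕ) (X : Fin n → EuclideanSpace ℝ (Fin d))
    (x : EuclideanSpace ℝ (Fin d)) : Finset (Fin n) :=
  (Finset.univ.filter fun i : Fin n => (i : ℕ) < k).map
    (Tuple.sort fun j => ‖X j - x‖).toEmbedding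

lemma sum_neighborOrder {d n : ℕ} (k : ℕ) (D : Fin n → EuclideanSpace ℝ (Fin d) × ℝ)
    (x : EuclideanSpace ℝ (Fin d)) (F : Fin n → ℝ) :
    ∑ i ∈ Finset.univ.filter (fun i : Fin n => (i : ℕ) < k), F (neighborOrder D x i) =
      ∑ i ∈ nearestSet k (fun j => (D j).1) x, F i := by
  simp [nearestSet, neighborOrder]

lemma card_nearestSet {d n k : ℕ} (hk : k ≤ n) (X : Fin n → EuclideanSpace ℝ (Fin d))
    (x : EuclideanSpace ℝ (Fin d)) : (nearestSet k X x).card = k := by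
  simp [nearestSet, Fin.card_filter_val_lt, hk]

lemma lex_of_mem_nearestSet {d n k : ℕ} {X : Fin n → EuclideanSpace ℝ (Fin d)}
    {x : EuclideanSpace ℝ (Fin d)} {i j : Fin n} (hi : i ∈ nearestSet k X x)
    (hj : j ∉ nearestSet k X x) :
    ‖X i - x‖ < ‖X j - x‖ ∨ (‖X i - x‖ = ‖X j - x‖ ∧ i < j) := by
  obtain ⟨hm, ht⟩ := (Tuple.eq_sort_iff (f := fun j => ‖X j - x‖)).1 rfl
  set σ := Tuple.sort fun j => ‖X j - x‖ with hσ
  obtain ⟨i, rfl⟩ := σ.surjective i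
  obtain ⟨j, rfl⟩ := σ.surjective j
  simp only [nearestSet, ← hσ, Finset.mem_map_equiv, Finset.mem_filter, Finset.mem_univ, true_and,
    Equiv.symm_apply_apply] at hi hj
  have hij : i < j := by rw [Fin.lt_def]; omega
  rcases (hm hij.le).lt_or_eq with h | h
  · exact Or.inl h
  · exact Or.inr ⟨h, ht i j hij h⟩

/-- If at least `k` of the points lie within distance `s` of `x`, so do the `k` nearest ones. -/
lemma norm_sub_le_of_mem_nearestSet {d n k : ℕ} {X : Fin n → EuclideanSpace ℝ (Fin d)}
    {x : EuclideanSpace ℝ (Fin d)} {s : ℝ} (hkn : k ≤ n)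
    (hs : k ≤ (Finset.univ.filter fun i => ‖X i - x‖ ≤ s).card) {i : Fin n}
    (hi : i ∈ nearestSet k X x) : ‖X i - x‖ ≤ s := by
  by_contra hlt
  have hsub : Finset.univ.filter (fun i => ‖X i - x‖ ≤ s) ⊆ (nearestSet k X x).erase i := by
    intro j hj
    simp only [Finset.mem_filter, Finset.mem_univ, true_and] at hj
    refine Finset.mem_erase.2 ⟨fun h => hlt (h ▸ hj), ?_⟩
    by_contra hjn
    rcases lex_of_mem_nearestSet hi hjn with h | ⟨h, _⟩ <;> linarith
  have h1 := Finset.card_le_card hsub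
  have h2 := Finset.card_erase_lt_of_mem hi
  rw [card_nearestSet hkn] at h2
  omega

/-- A set of indices shattered by the nearest-neighbour sets has at most `d + 3` elements. -/
lemma card_le_of_shatters_nearestSet {d n k : ℕ} (X : Fin n → EuclideanSpace ℝ (Fin d))
    (𝒜 : Finset (Finset (Fin n))) (h𝒜 : ∀ S ∈ 𝒜, ∃ x, nearestSet k X x = S)
    (T : Finset (Fin n)) (hT : 𝒜.Shatters T) : T.card ≤ d + 3 := by
  by_contra! hcard
  -- The lift makes squared distances to x, with ties broken by index, affine in the lifted point.
  -- The target has dimension d + 2, so more than d + 3 points have a Radon partition.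
  let p : T → EuclideanSpace ℝ (Fin d) × ℝ × ℝ :=
    fun i => (X i, ‖X i‖ ^ 2, ((i : Fin n) : ℕ))
  have hp : ¬ AffineIndependent ℝ p := by
    intro h
    have h1 := h.card_le_finrank_succ
    have h2 := Submodule.finrank_le (vectorSpan ℝ (Set.range p))
    simp only [Fintype.card_coe, Module.finrank_prod, finrank_euclideanSpace, Fintype.card_fin,
      Module.finrank_self] at h1 h2
    omega
  obtain ⟨I, z, hzI, hzJ⟩ := Convex.radon_partition hp
  classical
  obtain ⟨u, hu, hTu⟩ := hT (t := T.filter fun i => ∃ h : i ∈ T, (⟨i, h⟩ : T) ∈ I)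
    (Finset.filter_subset _ _)
  obtain ⟨x, rfl⟩ := h𝒜 u hu
  have hmem : ∀ i : T, (i : Fin n) ∈ nearestSet k X x ↔ i ∈ I := by
    intro i
    have := Finset.ext_iff.1 hTu i
    simpa using this
  -- A small δ > 0 turns the lexicographic order into one strict inequality: it preserves the
  -- finitely many strict comparisons of distances and decides ties by index.
  have key : ∃ δ : ℝ, ∀ i j : T, i ∈ I → j ∉ I →
      ‖X i - x‖ ^ 2 + δ * ((i : Fin n) : ℕ) < ‖X j - x‖ ^ 2 + δ * ((j : Fin n) : ℕ) := by
    have : ∀ᶠ δ : ℝ in nhdsWithin 0 (Set.Ioi 0), ∀ i j : T, i ∈ I → j ∉ I →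
      ‖X i - x‖ ^ 2 + δ * ((i : Fin n) : ℕ) < ‖X j - x‖ ^ 2 + δ * ((j : Fin n) : ℕ) := by
      rw [Filter.eventually_all]; intro i
      rw [Filter.eventually_all]; intro j
      rw [Filter.eventually_imp_distrib_left]; intro hi
      rw [Filter.eventually_imp_distrib_left]; intro hj
      rcases lex_of_mem_nearestSet ((hmem i).2 hi) (fun h => hj ((hmem j).1 h)) with h | ⟨h, hij⟩
      · apply nhdsWithin_le_nhds
        have hl : ContinuousAt (fun δ : ℝ => ‖X i - x‖ ^ 2 + δ * ((i : Fin n) : ℕ)) 0 := by fun_prop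
        have hr : ContinuousAt (fun δ : ℝ => ‖X j - x‖ ^ 2 + δ * ((j : Fin n) : ℕ)) 0 := by fun_prop
        refine hl.eventually_lt hr ?_
        have := norm_nonneg (X i - x)
        simp only [zero_mul, add_zero]
        gcongr
      · filter_upwards [self_mem_nhdsWithin] with δ hδ
        rw [h]
        have : (((i : Fin n) : ℕ) : ℝ) < ((j : Fin n) : ℕ) := by exact_mod_cast hij
        have := mul_lt_mul_of_pos_left this (Set.mem_Ioi.1 hδ)
        linarith
    exact this.exists
  obtain ⟨δ, hδ⟩ := key
  let ℓ : (EuclideanSpace ℝ (Fin d) × ℝ × ℝ) →ₗ[ℝ] ℝ :=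
    { toFun := fun w => -2 * inner ℝ x w.1 + w.2.1 + δ * w.2.2
      map_add' := by intro a b; simp [inner_add_right]; ring
      map_smul' := by intro a b; simp [inner_smul_right]; ring }
  have hℓ : ∀ i : T, ℓ (p i) = ‖X i - x‖ ^ 2 + δ * ((i : Fin n) : ℕ) - ‖x‖ ^ 2 := by
    intro i
    simp only [ℓ, p, LinearMap.coe_mk, AddHom.coe_mk, norm_sub_sq_real, real_inner_comm x]
    ring
  have h1 : ∀ j : T, j ∉ I → ℓ z < ℓ (p j) := by
    intro j hj
    have : convexHull ℝ (p '' I) ⊆ {w | ℓ w < ℓ (p j)} := by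
      refine convexHull_min ?_ (convex_halfSpace_lt ℓ.isLinear _)
      rintro _ ⟨i, hi, rfl⟩
      simp only [Set.mem_ofPred_eq, hℓ]
      linarith [hδ i j hi hj]
    exact this hzI
  have h2 : convexHull ℝ (p '' Iᶜ) ⊆ {w | ℓ z < ℓ w} := by
    refine convexHull_min ?_ (convex_halfSpace_gt ℓ.isLinear _)
    rintro _ ⟨j, hj, rfl⟩
    exact h1 j hj
  exact lt_irrefl (ℓ z) (by simpa using h2 hzJ)

/-- Turns the Sauer–Shelah sum into a power of n + 1, whose logarithm is the price of the union
bound. -/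
lemma sum_choose_le (n m : ℕ) : ∑ j ∈ Finset.Iic m, n.choose j ≤ (n + 1) ^ m := by
  induction m with
  | zero =>
    have : Finset.Iic 0 = {0} := by ext; simp
    simp [this]
  | succ m ih =>
    have : Finset.Iic (m + 1) = insert (m + 1) (Finset.Iic m) := by ext; simp; omega
    rw [this, Finset.sum_insert (by simp)]
    rcases Nat.eq_zero_or_pos m with rfl | hm
    · have : Finset.Iic 0 = {0} := by ext; simp
      simp [this]
    have h1 : n.choose (m + 1) ≤ n ^ (m + 1) := Nat.choose_le_pow n (m + 1)
    have h2 : n ^ (m + 1) ≤ n * (n + 1) ^ m := by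
      rw [pow_succ, mul_comm]; gcongr; omega
    calc _ ≤ n * (n + 1) ^ m + (n + 1) ^ m := by omega
      _ = (n + 1) ^ (m + 1) := by ring

/-- The number of distinct nearest-neighbour sets is polynomial in the number of points. -/
lemma card_le_of_forall_nearestSet {d n k : ℕ} (X : Fin n → EuclideanSpace ℝ (Fin d))
    (𝒜 : Finset (Finset (Fin n))) (h𝒜 : ∀ S ∈ 𝒜, ∃ x, nearestSet k X x = S) :
    𝒜.card ≤ (n + 1) ^ (d + 3) := by
  -- Sauer–Shelah.
  have h1 := 𝒜.card_le_card_shatterer.trans Finset.card_shatterer_le_sum_vcDim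
  rw [Fintype.card_fin] at h1
  have h2 : 𝒜.vcDim ≤ d + 3 := Finset.sup_le fun T hT =>
    card_le_of_shatters_nearestSet X 𝒜 h𝒜 T (Finset.mem_shatterer.1 hT)
  exact h1.trans ((sum_choose_le n _).trans (Nat.pow_le_pow_right (by omega) h2))

/-! ### Measurability of the supremum over an uncountable set -/

/-- Projection along a compact factor is a closed map. This keeps existential quantifiers over C
within the Borel sets. -/
lemma IsCompact.isClosed_exists_mem {Y Z : Type*} [TopologicalSpace Y] [TopologicalSpace Z]
    {C : Set Z} (hC : IsCompact C) {F : Set (Y × Z)} (hF : IsClosed F) :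
    IsClosed {y | ∃ x ∈ C, (y, x) ∈ F} := by
  have : CompactSpace C := isCompact_iff_compactSpace.1 hC
  have h := isClosedMap_fst_of_compactSpace (X := Y) (Y := C) _
    (hF.preimage (f := fun p : Y × C => (p.1, (p.2 : Z))) (by fun_prop))
  convert h using 1
  ext y
  simp

/-- Being sorted by a given permutation, for the distances to some point of a compact set at which
a continuous function is less than `q`, is a measurable condition on the points. -/
lemma measurableSet_exists_sort_eq {d n : ℕ} {C : Set (EuclideanSpace ℝ (Fin d))}
    (hC : IsCompact C) {u : EuclideanSpace ℝ (Fin d) → ℝ} (hu : Continuous u)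
    (σ : Equiv.Perm (Fin n)) (q : ℝ) :
    MeasurableSet {X : Fin n → EuclideanSpace ℝ (Fin d) |
      ∃ x ∈ C, Tuple.sort (fun j => ‖X j - x‖) = σ ∧ u x < q} := by
  -- Strict inequalities, both in the tie-breaking and in u x < q, are exhausted by closed
  -- conditions with slack 1/(m + 1). The set becomes a countable union of projections of closed
  -- sets along C.
  let F : ℕ → Set ((Fin n → EuclideanSpace ℝ (Fin d)) × EuclideanSpace ℝ (Fin d)) := fun m =>
    {p | (∀ i j, i < j → ‖p.1 (σ i) - p.2‖ + (if σ i < σ j then 0 else 1 / ((m : ℝ) + 1)) ≤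
      ‖p.1 (σ j) - p.2‖) ∧ u p.2 + 1 / ((m : ℝ) + 1) ≤ q}
  have hF : ∀ m, IsClosed (F m) := by
    intro m
    refine IsClosed.and ?_ ?_
    · simp only [Set.ofPred_forall]
      refine isClosed_iInter fun i => isClosed_iInter fun j => isClosed_iInter fun _ => ?_
      exact isClosed_le (by fun_prop) (by fun_prop)
    · exact isClosed_le (by fun_prop) (by fun_prop)
  have heq : {X : Fin n → EuclideanSpace ℝ (Fin d) |
      ∃ x ∈ C, Tuple.sort (fun j => ‖X j - x‖) = σ ∧ u x < q} =
      ⋃ m, {X | ∃ x ∈ C, (X, x) ∈ F m} := by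
    ext X
    simp only [Set.mem_ofPred_eq, Set.mem_iUnion, F]
    constructor
    · rintro ⟨x, hx, hσ, hq⟩
      obtain ⟨hm, ht⟩ := Tuple.eq_sort_iff.1 hσ.symm
      have hev : ∀ᶠ m : ℕ in Filter.atTop, (∀ i j, i < j → ‖X (σ i) - x‖ +
          (if σ i < σ j then 0 else 1 / ((m : ℝ) + 1)) ≤ ‖X (σ j) - x‖) ∧
          u x + 1 / ((m : ℝ) + 1) ≤ q := by
        have hlim : ∀ c : ℝ, 0 < c → ∀ᶠ m : ℕ in Filter.atTop, 1 / ((m : ℝ) + 1) ≤ c :=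
          fun c hc => (tendsto_one_div_add_atTop_nhds_zero_nat.eventually_lt_const hc).mono
            fun _ h => h.le
        refine Filter.Eventually.and ?_ ((hlim (q - u x) (by linarith)).mono
          fun m hm => by linarith)
        rw [Filter.eventually_all]; intro i
        rw [Filter.eventually_all]; intro j
        rw [Filter.eventually_imp_distrib_left]; intro hij
        by_cases h : σ i < σ j
        · have hle : ‖X (σ i) - x‖ ≤ ‖X (σ j) - x‖ := hm hij.le
          simp [h, hle]
        · have hlt : ‖X (σ i) - x‖ < ‖X (σ j) - x‖ :=
            lt_of_le_of_ne (hm hij.le) fun he => h (ht i j hij he)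
          refine (hlim _ (sub_pos.2 hlt)).mono fun m hm => ?_
          rw [if_neg h]; linarith
      obtain ⟨m, hm⟩ := hev.exists
      exact ⟨m, x, hx, hm⟩
    · rintro ⟨m, x, hx, h, hq⟩
      have hpos : 0 < 1 / ((m : ℝ) + 1) := by positivity
      refine ⟨x, hx, (Tuple.eq_sort_iff.2 ⟨?_, ?_⟩).symm, by linarith⟩
      · refine monotone_iff_forall_lt.2 fun i j hij => ?_
        have := h i j hij
        simp only [Function.comp_apply]
        split_ifs at this <;> linarith
      · intro i j hij he
        by_contra hn
        have := h i j hij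
        rw [if_neg hn] at this
        linarith
  rw [heq]
  exact MeasurableSet.iUnion fun m => (hC.isClosed_exists_mem (hF m)).measurableSet

lemma measurableSet_exists_nearestSet_eq {d n : ℕ} {C : Set (EuclideanSpace ℝ (Fin d))}
    (hC : IsCompact C) (k : ℕ) (S : Finset (Fin n)) :
    MeasurableSet {X : Fin n → EuclideanSpace ℝ (Fin d) | ∃ x ∈ C, nearestSet k X x = S} := by
  have heq : {X : Fin n → EuclideanSpace ℝ (Fin d) | ∃ x ∈ C, nearestSet k X x = S} =
      ⋃ σ : Equiv.Perm (Fin n), ⋃ _ : (Finset.univ.filter fun i : Fin n => (i : ℕ) < k).map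
        σ.toEmbedding = S, {X : Fin n → EuclideanSpace ℝ (Fin d) |
      ∃ x ∈ C, Tuple.sort (fun j => ‖X j - x‖) = σ ∧ (fun _ => (0 : ℝ)) x < 1} := by
    ext X
    simp [nearestSet, and_comm]
  rw [heq]
  exact MeasurableSet.iUnion fun σ => MeasurableSet.iUnion fun _ =>
    measurableSet_exists_sort_eq hC continuous_const σ 1

lemma measurableSet_sort_eq {Z : Type*} [MeasurableSpace Z] {n : ℕ} {g : Fin n → Z → ℝ}
    (hg : ∀ i, Measurable (g i)) (σ : Equiv.Perm (Fin n)) :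
    MeasurableSet {z | Tuple.sort (fun i => g i z) = σ} := by
  have heq : {z | Tuple.sort (fun i => g i z) = σ} =
      {z | ∀ i j, i < j → g (σ i) z ≤ g (σ j) z ∧ (g (σ i) z = g (σ j) z → σ i < σ j)} := by
    ext z
    simp only [Set.mem_ofPred_eq, eq_comm (b := σ), Tuple.eq_sort_iff, monotone_iff_forall_lt]
    exact ⟨fun h i j hij => ⟨h.1 hij, h.2 i j hij⟩,
      fun h => ⟨fun i j hij => (h i j hij).1, fun i j hij => (h i j hij).2⟩⟩
  rw [heq]
  simp only [Set.ofPred_forall]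
  refine MeasurableSet.iInter fun i => MeasurableSet.iInter fun j => MeasurableSet.iInter fun _ => ?_
  refine (measurableSet_le (hg (σ i)) (hg (σ j))).inter ?_
  by_cases h : σ i < σ j
  · simp only [h, implies_true]
    exact MeasurableSet.univ
  · simp only [h, imp_false]
    exact (measurableSet_eq_fun (hg _) (hg _)).compl

lemma measurable_knnRegression_apply {d n : ℕ} (k : ℕ) (j : Fin n) :
    Measurable fun D : Fin n → EuclideanSpace ℝ (Fin d) × ℝ => knnRegression k D (D j).1 := by
  classical
  have heq : (fun D : Fin n → EuclideanSpace ℝ (Fin d) × ℝ => knnRegression k D (D j).1) =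
      fun D => ∑ σ : Equiv.Perm (Fin n), if Tuple.sort (fun i => ‖(D i).1 - (D j).1‖) = σ then
        (1 / (k : ℝ)) * ∑ i ∈ Finset.univ.filter (fun i : Fin n => (i : ℕ) < k), (D (σ i)).2
        else 0 := by
    funext D
    simp [knnRegression, neighborOrder]
  rw [heq]
  refine Finset.measurable_sum _ fun σ _ => Measurable.ite
    (measurableSet_sort_eq (g := fun i (D : Fin n → EuclideanSpace ℝ (Fin d) × ℝ) =>
      ‖(D i).1 - (D j).1‖) (fun i => by fun_prop) σ) ?_ measurable_const
  fun_prop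

/-- The rational q separates the estimator, which depends only on the data once the sorting
permutation is fixed, from the value of v at x. The point x then occurs only in a condition covered
by `measurableSet_exists_sort_eq`, with u = v or, for the second alternative, u = -v. -/
lemma lt_abs_sub_iff_exists_rat (s a b : ℝ) :
    s < |a - b| ↔ ∃ q : ℚ, (q < a ∧ b < q - s) ∨ (a < q ∧ -b < -(q + s)) := by
  constructor
  · intro h
    rcases lt_abs.1 h with h | h
    · obtain ⟨q, h1, h2⟩ := exists_rat_btwn (show b + s < a by linarith)
      exact ⟨q, Or.inl ⟨h2, by linarith⟩⟩
    · obtain ⟨q, h1, h2⟩ := exists_rat_btwn (show a < b - s by linarith)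
      exact ⟨q, Or.inr ⟨h1, by linarith⟩⟩
  · rintro ⟨q, ⟨h1, h2⟩ | ⟨h1, h2⟩⟩
    · exact lt_abs.2 (Or.inl (by linarith))
    · exact lt_abs.2 (Or.inr (by linarith))

lemma measurable_knnVarianceSupError {d n : ℕ} (k : ℕ) {C : Set (EuclideanSpace ℝ (Fin d))}
    (hC : IsCompact C) {v : EuclideanSpace ℝ (Fin d) → ℝ} (hv : Continuous v) :
    Measurable (knnVarianceSupError (n := n) k C v) := by
  refine measurable_of_Ioi fun t => ?_
  by_cases ht : t = ⊤
  · simp [ht]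
  let W : Equiv.Perm (Fin n) → (Fin n → EuclideanSpace ℝ (Fin d) × ℝ) → ℝ := fun σ D =>
    (1 / (k : ℝ)) * ∑ i ∈ Finset.univ.filter (fun i : Fin n => (i : ℕ) < k),
      ((D (σ i)).2 - knnRegression k D (D (σ i)).1) ^ 2
  have hW : ∀ σ, Measurable (W σ) := by
    intro σ
    refine measurable_const.mul (Finset.measurable_sum _ fun i _ => ?_)
    exact (Measurable.sub (by fun_prop) (measurable_knnRegression_apply k (σ i))).pow_const 2
  let B : Equiv.Perm (Fin n) → (EuclideanSpace ℝ (Fin d) → ℝ) → ℝ →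
      Set (Fin n → EuclideanSpace ℝ (Fin d) × ℝ) := fun σ u q =>
    {D | ∃ x ∈ C, Tuple.sort (fun j => ‖(D j).1 - x‖) = σ ∧ u x < q}
  have hB : ∀ σ u q, Continuous u → MeasurableSet (B σ u q) := fun σ u q hu =>
    (measurableSet_exists_sort_eq hC hu σ q).preimage
      (f := fun (D : Fin n → EuclideanSpace ℝ (Fin d) × ℝ) j => (D j).1) (by fun_prop)
  have heq : knnVarianceSupError (n := n) k C v ⁻¹' Set.Ioi t =
      ⋃ σ : Equiv.Perm (Fin n), ⋃ q : ℚ, ({D | (q : ℝ) < W σ D} ∩ B σ v (q - t.toReal)) ∪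
        ({D | W σ D < q} ∩ B σ (fun x => -v x) (-(q + t.toReal))) := by
    ext D
    simp only [knnVarianceSupError, Set.mem_preimage, Set.mem_Ioi, lt_iSup_iff,
      ENNReal.lt_ofReal_iff_toReal_lt ht, lt_abs_sub_iff_exists_rat, Set.mem_iUnion, Set.mem_union,
      Set.mem_inter_iff, Set.mem_ofPred_eq, B]
    constructor
    · rintro ⟨x, hx, q, h⟩
      refine ⟨neighborOrder D x, q, ?_⟩
      rcases h with h | h
      · exact Or.inl ⟨h.1, x, hx, rfl, h.2⟩
      · exact Or.inr ⟨h.1, x, hx, rfl, h.2⟩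
    · rintro ⟨σ, q, ⟨h1, x, hx, rfl, h2⟩ | ⟨h1, x, hx, rfl, h2⟩⟩
      · exact ⟨x, hx, q, Or.inl ⟨h1, h2⟩⟩
      · exact ⟨x, hx, q, Or.inr ⟨h1, h2⟩⟩
  rw [heq]
  refine MeasurableSet.iUnion fun σ => MeasurableSet.iUnion fun q => MeasurableSet.union ?_ ?_
  · exact (measurableSet_lt measurable_const (hW σ)).inter (hB _ _ _ hv)
  · exact (measurableSet_lt (hW σ) measurable_const).inter (hB _ _ _ hv.neg)

/-! ### Integrating out the noise conditionally on the design -/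

section Decoupling

variable {E : Type*} [MeasurableSpace E]

lemma lintegral_fst_mul_le (ν : Measure (E × ℝ)) [IsProbabilityMeasure ν] {φ : E → ℝ≥0∞}
    (hφ : Measurable φ) {h : E × ℝ → ℝ≥0∞} (hh : Measurable h) {H : ℝ≥0∞}
    (hH : ∀ᵐ x ∂ν.fst, ∫⁻ y, h (x, y) ∂ν.condKernel x ≤ H) :
    ∫⁻ z, φ z.1 * h z ∂ν ≤ H * ∫⁻ z, φ z.1 ∂ν := by
  have e1 : ∫⁻ z, φ z.1 * h z ∂ν = ∫⁻ x, φ x * ∫⁻ y, h (x, y) ∂ν.condKernel x ∂ν.fst := by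
    conv_lhs => rw [← ν.disintegrate ν.condKernel]
    rw [Measure.lintegral_compProd (by fun_prop)]
    exact lintegral_congr fun x => 
      lintegral_const_mul (φ x) (f := fun y => h (x, y)) (hh.comp measurable_prodMk_left)
  have e2 : ∫⁻ z, φ z.1 ∂ν = ∫⁻ x, φ x ∂ν.fst := by
    rw [Measure.fst, lintegral_map hφ measurable_fst]
  rw [e1, e2, ← lintegral_const_mul _ hφ]
  refine lintegral_mono_ae (hH.mono fun x hx => ?_)
  rw [mul_comm]
  gcongr

/-- Hypothesis `hFi` expresses that F sees the second component of the i-th observation nowhere; the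
0 is a placeholder. With the other observations frozen, the bound on the conditional kernel applies
to the marginal integral over coordinate i. -/
lemma lintegral_pi_mul_apply_le {n : ℕ} (ν : Measure (E × ℝ)) [IsProbabilityMeasure ν]
    {h : E × ℝ → ℝ≥0∞} (hh : Measurable h) {H : ℝ≥0∞}
    (hH : ∀ᵐ x ∂ν.fst, ∫⁻ y, h (x, y) ∂ν.condKernel x ≤ H) (i : Fin n)
    {F : (Fin n → E × ℝ) → ℝ≥0∞} (hF : Measurable F)
    (hFi : ∀ D z, F (Function.update D i z) = F (Function.update D i (z.1, 0))) :
    ∫⁻ D, F D * h (D i) ∂Measure.pi (fun _ => ν) ≤ H * ∫⁻ D, F D ∂Measure.pi (fun _ => ν) := by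
  rw [← lintegral_const_mul _ hF]
  refine lintegral_le_of_lmarginal_le {i} (by fun_prop) (by fun_prop) fun D => ?_
  simp only [lmarginal_singleton, Function.update_self]
  have hm : Measurable fun x : E => F (Function.update D i (x, 0)) :=
    hF.comp ((measurable_update D).comp (by fun_prop))
  have e : ∫⁻ z, F (Function.update D i z) ∂ν = ∫⁻ z, F (Function.update D i (z.1, 0)) ∂ν :=
    lintegral_congr fun z => hFi D z
  calc ∫⁻ z, F (Function.update D i z) * h z ∂ν
      = ∫⁻ z, F (Function.update D i (z.1, 0)) * h z ∂ν :=
        lintegral_congr fun z => by rw [hFi]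
    _ ≤ H * ∫⁻ z, F (Function.update D i (z.1, 0)) ∂ν := lintegral_fst_mul_le ν hm hh hH
    _ = ∫⁻ z, H * F (Function.update D i z) ∂ν := by
        rw [← e]
        exact (lintegral_const_mul _ (hF.comp (measurable_update D))).symm

/-- Conditionally on the first components the second ones are independent, so that factors with
bounded conditional expectation can be integrated out one after the other. -/
lemma lintegral_pi_mul_prod_le {n : ℕ} (ν : Measure (E × ℝ)) [IsProbabilityMeasure ν]
    {h : E × ℝ → ℝ≥0∞} (hh : Measurable h) {H : ℝ≥0∞}
    (hH : ∀ᵐ x ∂ν.fst, ∫⁻ y, h (x, y) ∂ν.condKernel x ≤ H)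
    {φ : (Fin n → E) → ℝ≥0∞} (hφ : Measurable φ) (S : Finset (Fin n)) :
    ∫⁻ D, φ (fun j => (D j).1) * ∏ i ∈ S, h (D i) ∂Measure.pi (fun _ => ν) ≤
      H ^ S.card * ∫⁻ D, φ (fun j => (D j).1) ∂Measure.pi (fun _ => ν) := by
  induction S using Finset.induction_on with
  | empty => simp
  | insert i S hi ih =>
    have hφm : Measurable fun D : Fin n → E × ℝ => φ fun j => (D j).1 := hφ.comp (by fun_prop)
    have hF : Measurable fun D : Fin n → E × ℝ => φ (fun j => (D j).1) * ∏ j ∈ S, h (D j) :=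
      hφm.mul (by fun_prop)
    calc ∫⁻ D, φ (fun j => (D j).1) * ∏ j ∈ insert i S, h (D j) ∂Measure.pi (fun _ => ν)
        = ∫⁻ D, (φ (fun j => (D j).1) * ∏ j ∈ S, h (D j)) * h (D i) ∂Measure.pi (fun _ => ν) :=
          lintegral_congr fun D => by rw [Finset.prod_insert hi]; ring
      _ ≤ H * ∫⁻ D, φ (fun j => (D j).1) * ∏ j ∈ S, h (D j) ∂Measure.pi (fun _ => ν) := by
          refine lintegral_pi_mul_apply_le ν hh hH i hF fun D z => ?_
          congr 1
          · congr 1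
            funext j
            by_cases hj : j = i
            · subst hj; simp
            · simp [Function.update_of_ne hj]
          · refine Finset.prod_congr rfl fun j hj => ?_
            have hji : j ≠ i := fun h => hi (h ▸ hj)
            simp [Function.update_of_ne hji]
      _ ≤ H * (H ^ S.card * ∫⁻ D, φ (fun j => (D j).1) ∂Measure.pi (fun _ => ν)) := by gcongr
      _ = _ := by rw [Finset.card_insert_of_notMem hi]; ring

end Decoupling

/-! ### Maximal inequality for means over nearest-neighbour sets -/

/-- The event that `S` is the set of the `k` nearest neighbours of some point of `C`. -/
def nearestEvent {d n : ℕ} (k : ℕ) (C : Set (EuclideanSpace ℝ (Fin d))) (S : Finset (Fin n)) :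
    Set (Fin n → EuclideanSpace ℝ (Fin d) × ℝ) :=
  {D | ∃ x ∈ C, nearestSet k (fun j => (D j).1) x = S}

lemma measurableSet_nearestEvent {d n : ℕ} (k : ℕ) {C : Set (EuclideanSpace ℝ (Fin d))}
    (hC : IsCompact C) (S : Finset (Fin n)) : MeasurableSet (nearestEvent k C S) :=
  (measurableSet_exists_nearestSet_eq hC k S).preimage
    (f := fun (D : Fin n → EuclideanSpace ℝ (Fin d) × ℝ) j => (D j).1) (by fun_prop)

/-- The union bound. Each indicator is a function of the design, so the product integrates out to
H^k. The remaining sum of indicators counts the neighbour sets that occur, which is polynomial in n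
for every sample. -/
lemma lintegral_sum_nearestEvent_le {d n k : ℕ} (hkn : k ≤ n)
    {C : Set (EuclideanSpace ℝ (Fin d))} (hC : IsCompact C)
    (ν : Measure (EuclideanSpace ℝ (Fin d) × ℝ)) [IsProbabilityMeasure ν]
    {h : EuclideanSpace ℝ (Fin d) × ℝ → ℝ≥0∞} (hh : Measurable h) {H : ℝ≥0∞}
    (hH : ∀ᵐ x ∂ν.fst, ∫⁻ y, h (x, y) ∂ν.condKernel x ≤ H) :
    ∫⁻ D, ∑ S : Finset (Fin n), (nearestEvent k C S).indicator 1 D * ∏ i ∈ S, h (D i)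
      ∂Measure.pi (fun _ => ν) ≤ H ^ k * ((n + 1 : ℕ) : ℝ≥0∞) ^ (d + 3) := by
  classical
  have hm : ∀ S : Finset (Fin n), Measurable fun D => (nearestEvent k C S).indicator
      (1 : (Fin n → EuclideanSpace ℝ (Fin d) × ℝ) → ℝ≥0∞) D := fun S => measurable_one.indicator (measurableSet_nearestEvent k hC S)
  have hm' : ∀ S : Finset (Fin n), Measurable fun D : Fin n → EuclideanSpace ℝ (Fin d) × ℝ =>
      (nearestEvent k C S).indicator (1 : (Fin n → EuclideanSpace ℝ (Fin d) × ℝ) → ℝ≥0∞) D *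
        ∏ i ∈ S, h (D i) := fun S => (hm S).mul (by fun_prop)
  rw [lintegral_finsetSum _ fun S _ => hm' S]
  have key : ∀ S : Finset (Fin n), ∫⁻ D, (nearestEvent k C S).indicator 1 D * ∏ i ∈ S, h (D i)
      ∂Measure.pi (fun _ => ν) ≤
      H ^ k * ∫⁻ D, (nearestEvent k C S).indicator 1 D ∂Measure.pi (fun _ => ν) := by
    intro S
    by_cases hS : S.card = k
    · rw [← hS]
      exact lintegral_pi_mul_prod_le ν hh hH (φ := {X | ∃ x ∈ C, nearestSet S.card X x = S}.indicator 1)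
        (measurable_one.indicator (measurableSet_exists_nearestSet_eq hC _ S)) S
    · have : nearestEvent k C S = ∅ := by
        ext D
        simp only [nearestEvent, Set.mem_ofPred_eq, Set.mem_empty_iff_false, iff_false]
        rintro ⟨x, -, rfl⟩
        exact hS (card_nearestSet hkn _ _)
      simp [this]
  refine (Finset.sum_le_sum fun S _ => key S).trans ?_
  rw [← Finset.mul_sum, ← lintegral_finsetSum _ fun S _ => hm S]
  gcongr
  calc ∫⁻ D, ∑ S : Finset (Fin n), (nearestEvent k C S).indicator 1 D ∂Measure.pi (fun _ => ν)
      ≤ ∫⁻ _, ((n + 1 : ℕ) : ℝ≥0∞) ^ (d + 3) ∂Measure.pi (fun _ : Fin n => ν) := by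
        refine lintegral_mono fun D => ?_
        have hc := card_le_of_forall_nearestSet (k := k) (fun j => (D j).1)
          (Finset.univ.filter fun S => D ∈ nearestEvent k C S) (by
            intro S hS
            obtain ⟨x, -, hx⟩ := (Finset.mem_filter.1 hS).2
            exact ⟨x, hx⟩)
        calc ∑ S : Finset (Fin n), (nearestEvent k C S).indicator 1 D
            = ((Finset.univ.filter fun S => D ∈ nearestEvent k C S).card : ℝ≥0∞) := by
              simp [Set.indicator_apply]
          _ ≤ _ := by exact_mod_cast hc
    _ = _ := by simp

/-- The largest absolute mean of `g` over the `k` nearest neighbours of a point of `C`. -/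
noncomputable def nearestSup {d n : ℕ} (k : ℕ) (C : Set (EuclideanSpace ℝ (Fin d)))
    (g : EuclideanSpace ℝ (Fin d) × ℝ → ℝ) (D : Fin n → EuclideanSpace ℝ (Fin d) × ℝ) : ℝ :=
  Finset.univ.sup' Finset.univ_nonempty fun S : Finset (Fin n) =>
    (nearestEvent k C S).indicator (fun D => |(1 / (k : ℝ)) * ∑ i ∈ S, g (D i)|) D

lemma measurable_nearestSup {d n : ℕ} (k : ℕ) {C : Set (EuclideanSpace ℝ (Fin d))}
    (hC : IsCompact C) {g : EuclideanSpace ℝ (Fin d) × ℝ → ℝ} (hg : Measurable g) :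
    Measurable (nearestSup (n := n) k C g) := by
  have := Finset.measurable_sup' (Finset.univ_nonempty (α := Finset (Fin n)))
    (f := fun S => (nearestEvent (d := d) k C S).indicator
      (fun D => |(1 / (k : ℝ)) * ∑ i ∈ S, g (D i)|)) fun S _ => by
        refine Measurable.indicator ?_ (measurableSet_nearestEvent k hC S)
        fun_prop
  convert this using 1
  funext D
  simp [nearestSup, Finset.sup'_apply]

lemma abs_mean_le_nearestSup {d n k : ℕ} {C : Set (EuclideanSpace ℝ (Fin d))}
    (g : EuclideanSpace ℝ (Fin d) × ℝ → ℝ) (D : Fin n → EuclideanSpace ℝ (Fin d) × ℝ)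
    {x : EuclideanSpace ℝ (Fin d)} (hx : x ∈ C) :
    |(1 / (k : ℝ)) * ∑ i ∈ nearestSet k (fun j => (D j).1) x, g (D i)| ≤ nearestSup k C g D := by
  have h := Finset.le_sup' (f := fun S : Finset (Fin n) =>
    (nearestEvent k C S).indicator (fun D => |(1 / (k : ℝ)) * ∑ i ∈ S, g (D i)|) D)
    (Finset.mem_univ (nearestSet k (fun j => (D j).1) x))
  rwa [Set.indicator_of_mem (show D ∈ nearestEvent k C _ from ⟨x, hx, rfl⟩)] at h

lemma nearestSup_nonneg {d n k : ℕ} {C : Set (EuclideanSpace ℝ (Fin d))}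
    (g : EuclideanSpace ℝ (Fin d) × ℝ → ℝ) (D : Fin n → EuclideanSpace ℝ (Fin d) × ℝ) :
    0 ≤ nearestSup k C g D :=
  (Set.indicator_nonneg (fun _ _ => abs_nonneg _) D).trans
    (Finset.le_sup' (f := fun S : Finset (Fin n) =>
      (nearestEvent k C S).indicator (fun D => |(1 / (k : ℝ)) * ∑ i ∈ S, g (D i)|) D)
      (Finset.mem_univ ∅))

/-- Beyond 2M, w is at most 2(w − M), and a power is dominated by an exponential. The factor exp(-M)
is there to cancel the size of the union bound. -/
lemma pow_le_add_exp (m : ℕ) {w M : ℝ} (hM : 0 ≤ M) (hw : 0 ≤ w) :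
    w ^ m ≤ (2 * M) ^ m + 2 ^ m * m.factorial * Real.exp (w - M) := by
  rcases le_total w (2 * M) with h | h
  · have : w ^ m ≤ (2 * M) ^ m := by gcongr
    have : 0 ≤ 2 ^ m * m.factorial * Real.exp (w - M) := by positivity
    linarith
  · have h1 : w ^ m ≤ (2 * (w - M)) ^ m := by gcongr; linarith
    have h2 := Real.pow_div_factorial_le_exp (w - M) (by linarith) m
    rw [div_le_iff₀ (by positivity)] at h2
    have h3 : (2 * (w - M)) ^ m ≤ 2 ^ m * m.factorial * Real.exp (w - M) := by
      rw [mul_pow, mul_assoc]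
      gcongr
      linarith
    have : 0 ≤ (2 * M) ^ m := by positivity
    linarith

lemma exp_le_one_add_add_sq {t : ℝ} (ht : |t| ≤ 1) : Real.exp t ≤ 1 + t + t ^ 2 := by
  have := (abs_le.1 (Real.abs_exp_sub_one_sub_id_le ht)).2
  linarith

lemma one_add_add_sq_nonneg (t : ℝ) : 0 ≤ 1 + t + t ^ 2 := by nlinarith [sq_nonneg (t + 1 / 2)]

/-- Pointwise bound for a power of an absolute mean: if all the terms are moderate, the
exponential of the rescaled mean is controlled by two products; otherwise the largest term
dominates. -/
lemma pow_abs_mean_le {n k m q : ℕ} (hk : 1 ≤ k) {M : ℝ} (hM : 0 ≤ M) (ξ : Fin n → ℝ)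
    (S : Finset (Fin n)) (hS : S.card = k) :
    (√k * |(1 / (k : ℝ)) * ∑ i ∈ S, ξ i|) ^ m ≤ (2 * M) ^ m +
      2 ^ m * m.factorial * Real.exp (-M) * (∏ i ∈ S, (1 + ξ i / √k + (ξ i / √k) ^ 2) +
        ∏ i ∈ S, (1 + -ξ i / √k + (-ξ i / √k) ^ 2)) +
      (√k) ^ m * (1 / √k) ^ q * ∑ i, |ξ i| ^ (m + q) := by
  have hk0 : (0 : ℝ) < k := by exact_mod_cast hk
  have hsk : 0 < √(k : ℝ) := Real.sqrt_pos.2 hk0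
  have hp1 : 0 ≤ ∏ i ∈ S, (1 + ξ i / √k + (ξ i / √k) ^ 2) :=
    Finset.prod_nonneg fun i _ => one_add_add_sq_nonneg _
  have hp2 : 0 ≤ ∏ i ∈ S, (1 + -ξ i / √k + (-ξ i / √k) ^ 2) :=
    Finset.prod_nonneg fun i _ => one_add_add_sq_nonneg _
  have hs : 0 ≤ (√k) ^ m * (1 / √k) ^ q * ∑ i, |ξ i| ^ (m + q) := by positivity
  -- If all rescaled terms are at most 1, the quadratic bound for exp applies, with one product for
  -- each sign of the sum. Otherwise the largest |ξ i| exceeds √k, bounds the mean, and allows a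
  -- free factor (|ξ i| / √k)^q ≥ 1.
  by_cases hG : ∀ i ∈ S, |ξ i / √k| ≤ 1
  · have hw : √k * |(1 / (k : ℝ)) * ∑ i ∈ S, ξ i| = |∑ i ∈ S, ξ i / √k| := by
      rw [← Finset.sum_div, abs_mul, abs_div (∑ i ∈ S, ξ i), abs_of_pos hsk,
        abs_of_pos (by positivity : (0 : ℝ) < 1 / k)]
      nth_rewrite 2 [← Real.mul_self_sqrt hk0.le]
      field_simp
    have he : Real.exp |∑ i ∈ S, ξ i / √k| ≤ ∏ i ∈ S, (1 + ξ i / √k + (ξ i / √k) ^ 2) +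
        ∏ i ∈ S, (1 + -ξ i / √k + (-ξ i / √k) ^ 2) := by
      rcases abs_cases (∑ i ∈ S, ξ i / √k) with ⟨h, -⟩ | ⟨h, -⟩
      · rw [h, Real.exp_sum]
        have := Finset.prod_le_prod (fun i (_ : i ∈ S) => (Real.exp_pos (ξ i / √k)).le)
          fun i hi => exp_le_one_add_add_sq (hG i hi)
        linarith
      · rw [h, ← Finset.sum_neg_distrib, Real.exp_sum]
        have := Finset.prod_le_prod (fun i (_ : i ∈ S) => (Real.exp_pos (-(ξ i / √k))).le)
          fun i hi => exp_le_one_add_add_sq (t := -(ξ i / √k)) (by rw [abs_neg]; exact hG i hi)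
        simp only [← neg_div] at this ⊢
        linarith
    have h1 := pow_le_add_exp m hM (abs_nonneg (∑ i ∈ S, ξ i / √k))
    rw [hw]
    rw [Real.exp_sub, div_eq_mul_inv, ← Real.exp_neg, mul_comm (Real.exp |_|), ← mul_assoc] at h1
    have h2 := mul_le_mul_of_nonneg_left he
      (show 0 ≤ 2 ^ m * (m.factorial : ℝ) * Real.exp (-M) by positivity)
    linarith
  · push Not at hG
    obtain ⟨j, hj, hj1⟩ := hG
    obtain ⟨i, hi, hmax⟩ := Finset.exists_max_image S (fun i => |ξ i|) ⟨j, hj⟩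
    have h1 : |(1 / (k : ℝ)) * ∑ i ∈ S, ξ i| ≤ |ξ i| := by
      rw [abs_mul, abs_of_pos (by positivity : (0 : ℝ) < 1 / k), one_div, inv_mul_le_iff₀ hk0,
        ← hS, ← nsmul_eq_mul]
      exact (Finset.abs_sum_le_sum_abs _ _).trans (Finset.sum_le_card_nsmul _ _ _ hmax)
    have h2 : 1 ≤ 1 / √k * |ξ i| := by
      rw [abs_div, abs_of_pos hsk, div_eq_inv_mul, ← one_div] at hj1
      exact hj1.le.trans (mul_le_mul_of_nonneg_left (hmax j hj) (by positivity))
    have h3 : |ξ i| ^ (m + q) ≤ ∑ i, |ξ i| ^ (m + q) :=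
      Finset.single_le_sum (f := fun i => |ξ i| ^ (m + q)) (fun _ _ => by positivity)
        (Finset.mem_univ i)
    have h4 : (√k * |(1 / (k : ℝ)) * ∑ i ∈ S, ξ i|) ^ m ≤
        (√k) ^ m * (1 / √k) ^ q * ∑ i, |ξ i| ^ (m + q) := calc
      _ ≤ (√k * |ξ i|) ^ m * (1 / √k * |ξ i|) ^ q :=
        (pow_le_pow_left₀ (by positivity) (by gcongr) m).trans
          (le_mul_of_one_le_right (by positivity) (one_le_pow₀ h2))
      _ = (√k) ^ m * (1 / √k) ^ q * |ξ i| ^ (m + q) := by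
        rw [mul_pow, mul_pow, pow_add]; ring
      _ ≤ _ := by gcongr
    have h5 : 0 ≤ 2 ^ m * m.factorial * Real.exp (-M) *
      (∏ i ∈ S, (1 + ξ i / √k + (ξ i / √k) ^ 2) +
        ∏ i ∈ S, (1 + -ξ i / √k + (-ξ i / √k) ^ 2)) := by positivity
    have : 0 ≤ (2 * M) ^ m := by positivity
    linarith

/-- Centring removes the linear term, so two conditional moments suffice. -/
lemma lintegral_one_add_add_sq_le {κ : Measure ℝ} [IsProbabilityMeasure κ] {g : ℝ → ℝ} {V : ℝ}
    (h1 : Integrable g κ) (h0 : ∫ y, g y ∂κ = 0) (h2 : Integrable (fun y => g y ^ 2) κ)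
    (hV : ∫ y, g y ^ 2 ∂κ ≤ V) (k : ℕ) :
    ∫⁻ y, ENNReal.ofReal (1 + g y / √k + (g y / √k) ^ 2) ∂κ ≤ ENNReal.ofReal (1 + V / k) := by
  have hi1 : Integrable (fun y => g y / √k) κ := h1.div_const _
  have hi2 : Integrable (fun y => (g y / √k) ^ 2) κ := by
    simp_rw [div_pow]
    exact h2.div_const _
  have hi3 : Integrable (fun y => 1 + g y / √k) κ := (integrable_const 1).add hi1
  have hi4 : Integrable (fun y => 1 + g y / √k + (g y / √k) ^ 2) κ := hi3.add hi2
  rw [← ofReal_integral_eq_lintegral_ofReal hi4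
    (ae_of_all _ fun y => one_add_add_sq_nonneg _)]
  refine ENNReal.ofReal_le_ofReal ?_
  rw [integral_add hi3 hi2, integral_add (integrable_const 1) hi1]
  simp_rw [div_pow, Real.sq_sqrt (Nat.cast_nonneg k)]
  rw [integral_div, integral_div, h0]
  simp only [integral_const, probReal_univ, smul_eq_mul, mul_one, zero_div, add_zero]
  gcongr

/-- The sum over all nearest-neighbour sets `S` of points of `C` of the products over `S` of
`1 + t + t ^ 2`, `t = g / √k`. -/
noncomputable def nearestProdSum {d n : ℕ} (k : ℕ) (C : Set (EuclideanSpace ℝ (Fin d)))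
    (g : EuclideanSpace ℝ (Fin d) × ℝ → ℝ) (D : Fin n → EuclideanSpace ℝ (Fin d) × ℝ) : ℝ≥0∞ :=
  ∑ S : Finset (Fin n), (nearestEvent k C S).indicator 1 D *
    ∏ i ∈ S, ENNReal.ofReal (1 + g (D i) / √k + (g (D i) / √k) ^ 2)

lemma measurable_nearestProdSum {d n : ℕ} (k : ℕ) {C : Set (EuclideanSpace ℝ (Fin d))}
    (hC : IsCompact C) {g : EuclideanSpace ℝ (Fin d) × ℝ → ℝ} (hg : Measurable g) :
    Measurable (nearestProdSum (n := n) k C g) := by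
  refine Finset.measurable_sum _ fun S _ => (measurable_one.indicator
      (measurableSet_nearestEvent k hC S)).mul (Finset.measurable_prod _ fun i _ => ?_)
  fun_prop

lemma lintegral_nearestProdSum_le {d n k : ℕ} (hk : 1 ≤ k) (hkn : k ≤ n)
    {C : Set (EuclideanSpace ℝ (Fin d))} (hC : IsCompact C)
    (ν : Measure (EuclideanSpace ℝ (Fin d) × ℝ)) [IsProbabilityMeasure ν]
    {g : EuclideanSpace ℝ (Fin d) × ℝ → ℝ} (hg : Measurable g) {V : ℝ} (hV : 0 ≤ V)
    (h1 : ∀ᵐ x ∂ν.fst, Integrable (fun y => g (x, y)) (ν.condKernel x) ∧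
      ∫ y, g (x, y) ∂ν.condKernel x = 0)
    (h2 : ∀ᵐ x ∂ν.fst, Integrable (fun y => g (x, y) ^ 2) (ν.condKernel x) ∧
      ∫ y, g (x, y) ^ 2 ∂ν.condKernel x ≤ V) :
    ∫⁻ D, nearestProdSum k C g D ∂Measure.pi (fun _ : Fin n => ν) ≤
      ENNReal.ofReal (((n : ℝ) + 1) ^ (d + 3) * Real.exp V) := by
  have hk0 : (0 : ℝ) < k := by exact_mod_cast hk
  have hm : Measurable fun z => ENNReal.ofReal (1 + g z / √k + (g z / √k) ^ 2) := by fun_prop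
  have hc : ∀ᵐ x ∂ν.fst, ∫⁻ y, ENNReal.ofReal (1 + g (x, y) / √k + (g (x, y) / √k) ^ 2)
      ∂ν.condKernel x ≤ ENNReal.ofReal (1 + V / k) := by
    filter_upwards [h1, h2] with x hx1 hx2
    exact lintegral_one_add_add_sq_le hx1.1 hx1.2 hx2.1 hx2.2 k
  refine (lintegral_sum_nearestEvent_le hkn hC ν hm hc).trans ?_
  rw [ENNReal.ofReal_mul (by positivity), mul_comm, ENNReal.ofReal_pow (by positivity)]
  gcongr
  · rw [← ENNReal.ofReal_natCast]
    push_cast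
    exact le_rfl
  · rw [← ENNReal.ofReal_pow (by positivity)]
    refine ENNReal.ofReal_le_ofReal ?_
    calc (1 + V / k) ^ k ≤ (Real.exp (V / k)) ^ k := by
          gcongr
          rw [add_comm]
          exact Real.add_one_le_exp _
      _ = Real.exp V := by
          rw [← Real.exp_nat_mul]
          congr 1
          field_simp

lemma ofReal_prod_le_nearestProdSum {d n k : ℕ} {C : Set (EuclideanSpace ℝ (Fin d))}
    (g : EuclideanSpace ℝ (Fin d) × ℝ → ℝ) {D : Fin n → EuclideanSpace ℝ (Fin d) × ℝ}
    {S : Finset (Fin n)} (hD : D ∈ nearestEvent k C S) :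
    ENNReal.ofReal (∏ i ∈ S, (1 + g (D i) / √k + (g (D i) / √k) ^ 2)) ≤
      nearestProdSum k C g D := by
  rw [ENNReal.ofReal_prod_of_nonneg fun i _ => one_add_add_sq_nonneg _]
  refine le_trans ?_ (Finset.single_le_sum (f := fun S : Finset (Fin n) =>
    (nearestEvent k C S).indicator 1 D *
      ∏ i ∈ S, ENNReal.ofReal (1 + g (D i) / √k + (g (D i) / √k) ^ 2)) (fun _ _ => zero_le)
    (Finset.mem_univ S))
  simp [Set.indicator_of_mem hD]

/-- The maximum is attained at a single S; nonnegativity lets its products be replaced by the sum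
over all neighbour sets, whose integral is known. -/
lemma ofReal_nearestSup_pow_le {d n k m q : ℕ} (hk : 1 ≤ k) (hkn : k ≤ n)
    {C : Set (EuclideanSpace ℝ (Fin d))} (g : EuclideanSpace ℝ (Fin d) × ℝ → ℝ) {M : ℝ}
    (hM0 : 0 ≤ M) (D : Fin n → EuclideanSpace ℝ (Fin d) × ℝ) :
    ENNReal.ofReal ((√k * nearestSup k C g D) ^ m) ≤
      ENNReal.ofReal ((2 * M) ^ m) + (ENNReal.ofReal (2 ^ m * m.factorial * Real.exp (-M)) *
        (nearestProdSum k C g D + nearestProdSum k C (fun z => -g z) D) +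
        ENNReal.ofReal ((√k) ^ m * (1 / √k) ^ q) *
          ∑ i, ENNReal.ofReal (|g (D i)| ^ (m + q))) := by
  obtain ⟨S, -, hS⟩ := Finset.exists_mem_eq_sup' (Finset.univ_nonempty (α := Finset (Fin n)))
    fun S : Finset (Fin n) =>
      (nearestEvent k C S).indicator (fun D => |(1 / (k : ℝ)) * ∑ i ∈ S, g (D i)|) D
  change nearestSup k C g D = _ at hS
  by_cases hD : D ∈ nearestEvent k C S
  · rw [Set.indicator_of_mem hD] at hS
    have hcard : S.card = k := by
      obtain ⟨x, -, rfl⟩ := hD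
      exact card_nearestSet hkn _ _
    rw [hS]
    refine (ENNReal.ofReal_le_ofReal (pow_abs_mean_le (q := q) (m := m) hk hM0
      (fun i => g (D i)) S hcard)).trans ?_
    set c₁ : ℝ := 2 ^ m * m.factorial * Real.exp (-M)
    set c₂ : ℝ := (√k) ^ m * (1 / √k) ^ q
    have hc₁ : 0 ≤ c₁ := by positivity
    have hc₂ : 0 ≤ c₂ := by positivity
    rw [add_assoc]
    refine ENNReal.ofReal_add_le.trans (add_le_add le_rfl (ENNReal.ofReal_add_le.trans ?_))
    rw [ENNReal.ofReal_mul hc₁, ENNReal.ofReal_mul hc₂,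
      ENNReal.ofReal_sum_of_nonneg fun i _ => by positivity]
    gcongr
    exact ENNReal.ofReal_add_le.trans (add_le_add (ofReal_prod_le_nearestProdSum g hD)
      (ofReal_prod_le_nearestProdSum (fun z => -g z) hD))
  · rw [Set.indicator_of_notMem hD] at hS
    rw [hS, mul_zero]
    refine le_add_right (ENNReal.ofReal_le_ofReal ?_)
    gcongr
    positivity

lemma lintegral_nearestSup_pow_le {d n k m q : ℕ} (hk : 1 ≤ k) (hkn : k ≤ n)
    {C : Set (EuclideanSpace ℝ (Fin d))} (hC : IsCompact C)
    (ν : Measure (EuclideanSpace ℝ (Fin d) × ℝ)) [IsProbabilityMeasure ν]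
    {g : EuclideanSpace ℝ (Fin d) × ℝ → ℝ} (hg : Measurable g) {V : ℝ} (hV : 0 ≤ V)
    (h1 : ∀ᵐ x ∂ν.fst, Integrable (fun y => g (x, y)) (ν.condKernel x) ∧
      ∫ y, g (x, y) ∂ν.condKernel x = 0)
    (h2 : ∀ᵐ x ∂ν.fst, Integrable (fun y => g (x, y) ^ 2) (ν.condKernel x) ∧
      ∫ y, g (x, y) ^ 2 ∂ν.condKernel x ≤ V)
    {A : ℝ} (hA0 : 0 ≤ A) (hA : ∫⁻ z, ENNReal.ofReal (|g z| ^ (m + q)) ∂ν ≤ ENNReal.ofReal A) :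
    ∫⁻ D, ENNReal.ofReal ((√k * nearestSup k C g D) ^ m) ∂Measure.pi (fun _ : Fin n => ν) ≤
      ENNReal.ofReal ((2 * ((d + 3) * Real.log (n + 1) + V)) ^ m + 2 ^ (m + 1) * m.factorial +
        (√k) ^ m * (1 / √k) ^ q * (n * A)) := by
  -- This M makes exp M equal to the bound for each of the two product sums, so exp(-M) leaves only
  -- a constant.
  set M : ℝ := (d + 3) * Real.log (n + 1) + V with hM
  have hlog : 0 ≤ Real.log ((n : ℝ) + 1) :=
    Real.log_nonneg (by linarith [Nat.cast_nonneg (α := ℝ) n])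
  have hM0 : 0 ≤ M := by positivity
  have hexp : ((n : ℝ) + 1) ^ (d + 3) * Real.exp V = Real.exp M := by
    rw [hM, Real.exp_add]
    congr 1
    rw [show ((d : ℝ) + 3) = ((d + 3 : ℕ) : ℝ) by push_cast; ring, Real.exp_nat_mul,
      Real.exp_log (by positivity)]
  have hΨ1 := lintegral_nearestProdSum_le hk hkn hC ν hg hV h1 h2
  have hΨ2 := lintegral_nearestProdSum_le hk hkn hC ν hg.neg hV
    (h1.mono fun x hx => ⟨hx.1.neg, by simp [integral_neg, hx.2]⟩)
    (by simpa only [Pi.neg_apply, neg_sq] using h2)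
  rw [hexp] at hΨ1 hΨ2
  refine (lintegral_mono (ofReal_nearestSup_pow_le (q := q) hk hkn g hM0)).trans ?_
  have hsumm : Measurable fun D : Fin n → EuclideanSpace ℝ (Fin d) × ℝ =>
      ∑ i, ENNReal.ofReal (|g (D i)| ^ (m + q)) := by fun_prop
  have hm1 : Measurable (nearestProdSum (n := n) k C g) := measurable_nearestProdSum k hC hg
  have hm2 : Measurable fun D : Fin n → EuclideanSpace ℝ (Fin d) × ℝ =>
      nearestProdSum k C g D + nearestProdSum k C (fun z => -g z) D :=
    hm1.add (measurable_nearestProdSum k hC hg.neg)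
  rw [lintegral_add_left measurable_const, lintegral_add_left (hm2.const_mul _),
    lintegral_const_mul _ hm2, lintegral_const_mul _ hsumm, lintegral_add_left hm1,
    lintegral_finsetSum _ fun i _ => by fun_prop, lintegral_const, measure_univ, mul_one]
  have hcoord : ∀ i : Fin n, ∫⁻ D : Fin n → EuclideanSpace ℝ (Fin d) × ℝ,
      ENNReal.ofReal (|g (D i)| ^ (m + q)) ∂Measure.pi (fun _ => ν) ≤ ENNReal.ofReal A := by
    intro i
    rw [(measurePreserving_eval (fun _ : Fin n => ν) i).lintegral_comp
      (f := fun z => ENNReal.ofReal (|g z| ^ (m + q))) (by fun_prop)]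
    exact hA
  refine (add_le_add le_rfl (add_le_add (mul_le_mul_right (add_le_add hΨ1 hΨ2) _)
    (mul_le_mul_right (Finset.sum_le_sum fun i _ => hcoord i) _))).trans (le_of_eq ?_)
  rw [Finset.sum_const, Finset.card_univ, Fintype.card_fin, nsmul_eq_mul,
    ← ENNReal.ofReal_natCast, ← ENNReal.ofReal_mul (by positivity),
    ← ENNReal.ofReal_mul (by positivity), ← ENNReal.ofReal_add (by positivity) (by positivity),
    ← ENNReal.ofReal_mul (by positivity), ← ENNReal.ofReal_add (by positivity) (by positivity),
    ← ENNReal.ofReal_add (by positivity) (by positivity)]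
  congr 1
  have : 2 ^ m * (m.factorial : ℝ) * Real.exp (-M) * (Real.exp M + Real.exp M) =
      2 ^ (m + 1) * m.factorial := by
    rw [Real.exp_neg]
    field_simp
    ring
  rw [this, add_assoc]

/-! ### The rate and the moments of the maximal means -/

/-- The rate of convergence `log n / n ^ (1 / (d + 2))`. -/
noncomputable def knnRate (d n : ℕ) : ℝ := Real.log n * (n : ℝ) ^ (-(1 / ((d : ℝ) + 2)))

lemma half_le_log {n : ℕ} (hn : 2 ≤ n) : 1 / 2 ≤ Real.log n := by
  have h1 : Real.log 2 ≤ Real.log n := Real.log_le_log (by norm_num) (by exact_mod_cast hn)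
  linarith [Real.log_two_gt_d9]

lemma knnRate_pos {d n : ℕ} (hn : 2 ≤ n) : 0 < knnRate d n := by
  have h0 : (0 : ℝ) < n := by exact_mod_cast (by omega : 0 < n)
  have := half_le_log hn
  exact mul_pos (by linarith) (by positivity)

lemma sqrt_mul_rpow_le_sqrt {d n k : ℕ} {a : ℝ} (ha : 0 < a)
    (hk : a * (n : ℝ) ^ (2 / ((d : ℝ) + 2)) ≤ k) :
    √a * (n : ℝ) ^ (1 / ((d : ℝ) + 2)) ≤ √k := by
  refine Real.le_sqrt_of_sq_le (le_trans (le_of_eq ?_) hk)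
  rw [mul_pow, Real.sq_sqrt ha.le, ← Real.rpow_natCast, ← Real.rpow_mul (by positivity)]
  congr 2
  push_cast
  ring

lemma one_le_of_mul_rpow_le {d n k : ℕ} (hn : 2 ≤ n) {a : ℝ} (ha : 0 < a)
    (hk : a * (n : ℝ) ^ (2 / ((d : ℝ) + 2)) ≤ k) : 1 ≤ k := by
  have h0 : (0 : ℝ) < n := by exact_mod_cast (by omega : 0 < n)
  have : (0 : ℝ) < k := lt_of_lt_of_le (by positivity) hk
  exact_mod_cast this

/-- All moments of the largest mean of a centred function over the nearest neighbours are of the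
order of the rate. -/
lemma exists_lintegral_nearestSup_div_rate_le (d : ℕ) {a V : ℝ} (ha : 0 < a) (hV : 0 ≤ V)
    (A : ℕ → ℝ) (hA0 : ∀ j, 0 ≤ A j) (m : ℕ) :
    ∃ K : ℝ, 0 ≤ K ∧ ∀ (C : Set (EuclideanSpace ℝ (Fin d))), IsCompact C →
      ∀ (ν : Measure (EuclideanSpace ℝ (Fin d) × ℝ)) [IsProbabilityMeasure ν]
      (g : EuclideanSpace ℝ (Fin d) × ℝ → ℝ), Measurable g →
      (∀ᵐ x ∂ν.fst, Integrable (fun y => g (x, y)) (ν.condKernel x) ∧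
        ∫ y, g (x, y) ∂ν.condKernel x = 0) →
      (∀ᵐ x ∂ν.fst, Integrable (fun y => g (x, y) ^ 2) (ν.condKernel x) ∧
        ∫ y, g (x, y) ^ 2 ∂ν.condKernel x ≤ V) →
      (∀ j, ∫⁻ z, ENNReal.ofReal (|g z| ^ j) ∂ν ≤ ENNReal.ofReal (A j)) →
      ∀ n k : ℕ, 2 ≤ n → k ≤ n → a * (n : ℝ) ^ (2 / ((d : ℝ) + 2)) ≤ (k : ℝ) →
      ∫⁻ D, ENNReal.ofReal ((nearestSup k C g D / knnRate d n) ^ m)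
        ∂Measure.pi (fun _ : Fin n => ν) ≤ ENNReal.ofReal K := by
  have hA' := hA0 (m + (m + d + 2))
  refine ⟨(1 / √a) ^ m * ((2 * (2 * (d + 3) + 2 * V)) ^ m + 2 ^ m * (2 ^ (m + 1) * m.factorial) +
    2 ^ m * (A (m + (m + d + 2)) / √a ^ (d + 2))), by positivity, ?_⟩
  intro C hC ν _ g hg h1 h2 hA n k hn hkn hak
  have hk := one_le_of_mul_rpow_le hn ha hak
  have hk0 : (0 : ℝ) < k := by exact_mod_cast hk
  have hsk : 0 < √(k : ℝ) := Real.sqrt_pos.2 hk0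
  have hsa : 0 < √a := Real.sqrt_pos.2 ha
  have hn0 : (0 : ℝ) < n := by exact_mod_cast (by omega : 0 < n)
  have hn2 : (2 : ℝ) ≤ n := by exact_mod_cast hn
  have hL := half_le_log hn
  set L := Real.log n with hLdef
  have hL0 : 0 < L := by linarith
  have hmain := lintegral_nearestSup_pow_le (m := m) (q := m + d + 2) hk hkn hC ν hg hV h1 h2 hA'
    (hA _)
  have hsr := sqrt_mul_rpow_le_sqrt (d := d) ha hak
  -- A mean of size log n / √k is within the rate because √k ≥ √a · n^(1/(d+2)).
  have hrate : √a * L ≤ √k * knnRate d n := by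
    have e : (n : ℝ) ^ (1 / ((d : ℝ) + 2)) * (n : ℝ) ^ (-(1 / ((d : ℝ) + 2))) = 1 := by
      rw [← Real.rpow_add hn0]; simp
    calc √a * L = (√a * (n : ℝ) ^ (1 / ((d : ℝ) + 2))) * (L * (n : ℝ) ^ (-(1 / ((d : ℝ) + 2)))) := by
          linear_combination (-(√a * L)) * e
      _ ≤ √k * knnRate d n := by
          unfold knnRate
          gcongr
  have hpt : ∀ D : Fin n → EuclideanSpace ℝ (Fin d) × ℝ,
      ENNReal.ofReal ((nearestSup k C g D / knnRate d n) ^ m) ≤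
      ENNReal.ofReal ((1 / (√a * L)) ^ m) * ENNReal.ofReal ((√k * nearestSup k C g D) ^ m) := by
    intro D
    rw [← ENNReal.ofReal_mul (by positivity), ← mul_pow]
    refine ENNReal.ofReal_le_ofReal ?_
    have hT := nearestSup_nonneg (k := k) (C := C) g D
    have hr := knnRate_pos (d := d) hn
    refine pow_le_pow_left₀ (by positivity) ?_ m
    rw [div_le_iff₀ hr, one_div, mul_assoc, ← div_eq_inv_mul, le_div_iff₀ (by positivity)]
    nlinarith
  refine (lintegral_mono hpt).trans ?_
  rw [lintegral_const_mul' _ _ ENNReal.ofReal_ne_top]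
  refine (mul_le_mul_right hmain _).trans ?_
  rw [← ENNReal.ofReal_mul (by positivity)]
  refine ENNReal.ofReal_le_ofReal ?_
  have hlog1 : Real.log ((n : ℝ) + 1) ≤ 2 * L := by
    rw [hLdef, ← Real.log_rpow hn0 2]
    refine Real.log_le_log (by positivity) ?_
    norm_cast
    nlinarith
  have hlog0 : 0 ≤ Real.log ((n : ℝ) + 1) := Real.log_nonneg (by linarith)
  have hM : (d + 3) * Real.log (n + 1) + V ≤ (2 * (d + 3) + 2 * V) * L := by
    have : ((d : ℝ) + 3) * Real.log (n + 1) ≤ (d + 3) * (2 * L) := by gcongr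
    nlinarith
  -- The choice q = m + d + 2 leaves n / √k^(d+2), which is bounded because √k^(d+2) ≥ √a^(d+2) · n.
  have hthird : (√k) ^ m * (1 / √k) ^ (m + d + 2) * n ≤ 1 / √a ^ (d + 2) := by
    have e1 : (√k) ^ m * (1 / √k) ^ (m + d + 2) * n = n / √k ^ (d + 2) := by
      rw [add_assoc, pow_add, one_div_pow, one_div_pow]
      field_simp
    have e2 : √a ^ (d + 2) * n ≤ √k ^ (d + 2) := by
      refine le_trans (le_of_eq ?_) (pow_le_pow_left₀ (by positivity) hsr (d + 2))
      rw [mul_pow, ← Real.rpow_natCast ((n : ℝ) ^ _), ← Real.rpow_mul hn0.le]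
      congr 1
      rw [show 1 / ((d : ℝ) + 2) * ((d + 2 : ℕ) : ℝ) = 1 by push_cast; field_simp, Real.rpow_one]
    rw [e1, div_le_div_iff₀ (by positivity) (by positivity)]
    linarith
  have hinv : 1 / L ≤ 2 := by rw [div_le_iff₀ hL0]; linarith
  have t1 : (1 / L) ^ m * (2 * ((d + 3) * Real.log (n + 1) + V)) ^ m ≤
      (2 * (2 * (d + 3) + 2 * V)) ^ m := by
    rw [← mul_pow]
    refine pow_le_pow_left₀ (by positivity) ?_ m
    rw [one_div, inv_mul_le_iff₀ hL0]
    linarith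
  have t2 : (1 / L) ^ m * (2 ^ (m + 1) * m.factorial) ≤ 2 ^ m * (2 ^ (m + 1) * m.factorial) := by
    gcongr
  have t3 : (1 / L) ^ m * ((√k) ^ m * (1 / √k) ^ (m + d + 2) * (n * A (m + (m + d + 2)))) ≤
      2 ^ m * (A (m + (m + d + 2)) / √a ^ (d + 2)) := by
    have h := mul_le_mul_of_nonneg_right hthird hA'
    refine mul_le_mul (pow_le_pow_left₀ (by positivity) hinv m) ?_ (by positivity) (by positivity)
    calc _ = (√k) ^ m * (1 / √k) ^ (m + d + 2) * n * A (m + (m + d + 2)) := by ring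
      _ ≤ _ := h
      _ = _ := by ring
  have e3 : (1 / (√a * L)) ^ m = (1 / √a) ^ m * (1 / L) ^ m := by
    rw [← mul_pow]; congr 1; field_simp
  rw [e3, mul_assoc]
  refine mul_le_mul_of_nonneg_left ?_ (by positivity)
  rw [mul_add, mul_add]
  exact add_le_add (add_le_add t1 t2) t3

/-! ### The nearest-neighbour radius -/

/-- Under the strong density assumption on a regular compact set, balls of radius up to the diameter
have mass at least a constant times the `d`-th power of the radius. -/
lemma exists_le_measure_closedBall {d : ℕ} {C : Set (EuclideanSpace ℝ (Fin d))}
    (hC : IsCompact C) (hCreg : IsRegularSet C) {μmin : ℝ} (hμ : 0 < μmin) :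
    ∃ c R : ℝ, 0 < c ∧ 0 < R ∧ (∀ x ∈ C, ∀ y ∈ C, ‖x - y‖ ≤ R) ∧
      ∀ ρ : Measure (EuclideanSpace ℝ (Fin d)), StrongDensity ρ C μmin →
        ∀ x ∈ C, ∀ r : ℝ, 0 < r → r ≤ R →
          ENNReal.ofReal (c * r ^ d) ≤ ρ (Metric.closedBall x r) := by
  obtain ⟨κ, hκ, r₀, hr₀, hreg⟩ := hCreg
  set R := max r₀ (Metric.diam C) with hR
  have hR0 : 0 < R := lt_of_lt_of_le hr₀ (le_max_left _ _)
  set ω := (volume (Metric.ball (0 : EuclideanSpace ℝ (Fin d)) 1)).toReal with hω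
  have hωfin : volume (Metric.ball (0 : EuclideanSpace ℝ (Fin d)) 1) ≠ ⊤ :=
    measure_ball_lt_top.ne
  have hω0 : 0 < ω := ENNReal.toReal_pos (Metric.measure_ball_pos _ _ one_pos).ne' hωfin
  refine ⟨μmin * κ * ω * (r₀ / R) ^ d, R, by positivity, hR0, fun x hx y hy => ?_, ?_⟩
  · rw [← dist_eq_norm]
    exact (Metric.dist_le_diam_of_mem hC.isBounded hx hy).trans (le_max_right _ _)
  rintro ρ ⟨-, μ, μmax, hμm, rfl, hbd⟩ x hx r hr hrR
  -- Shrinking by r₀ / R brings every radius up to R into the range where regularity applies, at the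
  -- cost of a factor (r₀ / R)^d.
  set s := r * (r₀ / R) with hs
  have hs0 : 0 < s := by positivity
  have hsr₀ : s ≤ r₀ := by
    rw [hs, ← mul_div_assoc, div_le_iff₀ hR0, mul_comm]
    gcongr
  have hsr : s ≤ r := by
    rw [hs]
    exact mul_le_of_le_one_right hr.le ((div_le_one hR0).2 (le_max_left _ _))
  have hmeas : MeasurableSet (C ∩ Metric.closedBall x s) :=
    hC.isClosed.measurableSet.inter Metric.isClosed_closedBall.measurableSet
  calc ENNReal.ofReal (μmin * κ * ω * (r₀ / R) ^ d * r ^ d)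
      = ENNReal.ofReal μmin * (ENNReal.ofReal κ * volume (Metric.closedBall x s)) := by
        rw [Measure.addHaar_closedBall _ _ hs0.le, finrank_euclideanSpace, Fintype.card_fin,
          ← ENNReal.ofReal_toReal hωfin, ← hω, ← ENNReal.ofReal_mul (by positivity),
          ← ENNReal.ofReal_mul (by positivity), ← ENNReal.ofReal_mul (by positivity), hs, mul_pow]
        congr 1
        ring
    _ ≤ ENNReal.ofReal μmin * volume (C ∩ Metric.closedBall x s) := by
        gcongr
        exact hreg x hx s hs0 hsr₀
    _ = ∫⁻ _ in C ∩ Metric.closedBall x s, ENNReal.ofReal μmin := by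
        rw [setLIntegral_const]
    _ ≤ ∫⁻ y in C ∩ Metric.closedBall x s, ENNReal.ofReal (μ y) :=
        setLIntegral_mono (by fun_prop) fun y hy => ENNReal.ofReal_le_ofReal (hbd y hy.1).1
    _ = (volume.withDensity fun x => ENNReal.ofReal (μ x)) (C ∩ Metric.closedBall x s) := by
        rw [withDensity_apply _ hmeas]
    _ ≤ _ := measure_mono (Set.inter_subset_right.trans (Metric.closedBall_subset_closedBall hsr))

/-- `exp (-N)`, where `N` is the number of points at distance at most `r` from `y`. -/
noncomputable def expNegCount {d n : ℕ} (r : ℝ) (y : EuclideanSpace ℝ (Fin d))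
    (D : Fin n → EuclideanSpace ℝ (Fin d) × ℝ) : ℝ≥0∞ :=
  ∏ i, if ‖(D i).1 - y‖ ≤ r then ENNReal.ofReal (Real.exp (-1)) else 1

lemma measurable_expNegCount {d n : ℕ} (r : ℝ) :
    Measurable fun p : EuclideanSpace ℝ (Fin d) × (Fin n → EuclideanSpace ℝ (Fin d) × ℝ) =>
      expNegCount r p.1 p.2 := by
  refine Finset.measurable_prod _ fun i _ => Measurable.ite ?_ measurable_const measurable_const
  exact measurableSet_le (by fun_prop) (by fun_prop)

lemma one_le_exp_mul_expNegCount {d n k : ℕ} {r : ℝ} {y : EuclideanSpace ℝ (Fin d)}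
    {D : Fin n → EuclideanSpace ℝ (Fin d) × ℝ}
    (h : (Finset.univ.filter fun i => ‖(D i).1 - y‖ ≤ r).card ≤ k) :
    1 ≤ ENNReal.ofReal (Real.exp k) * expNegCount r y D := by
  rw [expNegCount, Finset.prod_ite, Finset.prod_const_one, mul_one, Finset.prod_const,
    ← ENNReal.ofReal_pow (Real.exp_pos _).le, ← ENNReal.ofReal_mul (Real.exp_pos _).le,
    ← Real.exp_nat_mul, ← Real.exp_add]
  rw [ENNReal.one_le_ofReal, Real.one_le_exp_iff]
  have : ((Finset.univ.filter fun i => ‖(D i).1 - y‖ ≤ r).card : ℝ) ≤ k := by exact_mod_cast h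
  linarith

/-- By independence the integral is the n-th power of 1 − P(1 − e⁻¹), where P ≥ p is the mass of the
ball, and e⁻¹ ≤ 1/2 bounds the base by exp(-p/2). -/
lemma lintegral_expNegCount_le {d n : ℕ} (ν : Measure (EuclideanSpace ℝ (Fin d) × ℝ))
    [IsProbabilityMeasure ν] {r p : ℝ} {y : EuclideanSpace ℝ (Fin d)}
    (hy : ENNReal.ofReal p ≤ ν.fst (Metric.closedBall y r)) :
    ∫⁻ D, expNegCount r y D ∂Measure.pi (fun _ : Fin n => ν) ≤
      ENNReal.ofReal (Real.exp (-(n * (p / 2)))) := by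
  let w : EuclideanSpace ℝ (Fin d) × ℝ → ℝ≥0∞ := fun z =>
    if ‖z.1 - y‖ ≤ r then ENNReal.ofReal (Real.exp (-1)) else 1
  have hBm : MeasurableSet {z : EuclideanSpace ℝ (Fin d) × ℝ | ‖z.1 - y‖ ≤ r} :=
    measurableSet_le (by fun_prop) measurable_const
  have hw : Measurable w := Measurable.ite hBm measurable_const measurable_const
  have h1 : ∫⁻ D, expNegCount r y D ∂Measure.pi (fun _ : Fin n => ν) = (∫⁻ z, w z ∂ν) ^ n := by
    have hind : iIndepFun (fun (i : Fin n) (D : Fin n → EuclideanSpace ℝ (Fin d) × ℝ) => w (D i))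
        (Measure.pi fun _ : Fin n => ν) := iIndepFun_pi fun _ => hw.aemeasurable
    have := lintegral_prod_eq_prod_lintegral_of_indepFun Finset.univ _ hind
      fun i => hw.comp (measurable_pi_apply i)
    rw [show (fun D => expNegCount r y D) = fun D : Fin n → EuclideanSpace ℝ (Fin d) × ℝ =>
      ∏ i, w (D i) from rfl, this]
    rw [Finset.prod_congr rfl fun i _ =>
      (measurePreserving_eval (fun _ : Fin n => ν) i).lintegral_comp hw]
    simp
  set P := (ν {z : EuclideanSpace ℝ (Fin d) × ℝ | ‖z.1 - y‖ ≤ r}).toReal with hP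
  have hPν : ν {z : EuclideanSpace ℝ (Fin d) × ℝ | ‖z.1 - y‖ ≤ r} = ENNReal.ofReal P :=
    (ENNReal.ofReal_toReal (measure_ne_top _ _)).symm
  have hfst : ν.fst (Metric.closedBall y r) = ENNReal.ofReal P := by
    rw [Measure.fst_apply Metric.isClosed_closedBall.measurableSet, ← hPν]
    congr 1
  have hpP : p ≤ P := by
    rw [hfst] at hy
    exact (ENNReal.ofReal_le_ofReal_iff ENNReal.toReal_nonneg).1 hy
  have hP0 : 0 ≤ P := ENNReal.toReal_nonneg
  have hP1 : P ≤ 1 := by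
    have : ν {z : EuclideanSpace ℝ (Fin d) × ℝ | ‖z.1 - y‖ ≤ r} ≤ 1 := prob_le_one
    rwa [hPν, ENNReal.ofReal_le_one] at this
  have hcompl : ν {z : EuclideanSpace ℝ (Fin d) × ℝ | ‖z.1 - y‖ ≤ r}ᶜ = ENNReal.ofReal (1 - P) := by
    rw [prob_compl_eq_one_sub hBm, hPν, ENNReal.ofReal_sub _ hP0, ENNReal.ofReal_one]
  have h2 : ∫⁻ z, w z ∂ν ≤ ENNReal.ofReal (Real.exp (-(p / 2))) := by
    have e1 : ∫⁻ z in {z : EuclideanSpace ℝ (Fin d) × ℝ | ‖z.1 - y‖ ≤ r}, w z ∂ν =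
        ∫⁻ _ in {z : EuclideanSpace ℝ (Fin d) × ℝ | ‖z.1 - y‖ ≤ r},
          ENNReal.ofReal (Real.exp (-1)) ∂ν :=
      setLIntegral_congr_fun hBm fun z hz => if_pos hz
    have e2 : ∫⁻ z in {z : EuclideanSpace ℝ (Fin d) × ℝ | ‖z.1 - y‖ ≤ r}ᶜ, w z ∂ν =
        ∫⁻ _ in {z : EuclideanSpace ℝ (Fin d) × ℝ | ‖z.1 - y‖ ≤ r}ᶜ, 1 ∂ν :=
      setLIntegral_congr_fun hBm.compl fun z hz => if_neg hz
    rw [← lintegral_add_compl w hBm, e1, e2,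
      setLIntegral_const, setLIntegral_const, hcompl, hPν, one_mul,
      ← ENNReal.ofReal_mul (Real.exp_pos _).le, ← ENNReal.ofReal_add (by positivity) (by linarith)]
    refine ENNReal.ofReal_le_ofReal ?_
    have he : Real.exp (-1) ≤ 1 / 2 := by
      have := Real.exp_neg_one_lt_d9
      linarith
    have := Real.add_one_le_exp (-(p / 2))
    nlinarith
  rw [h1]
  refine (pow_le_pow_left₀ zero_le h2 n).trans (le_of_eq ?_)
  rw [← ENNReal.ofReal_pow (Real.exp_pos _).le, ← Real.exp_nat_mul]
  congr 2
  ring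

/-- All the distances to the `k` nearest neighbours are at most `2 r`, outside an event of
exponentially small probability. -/
lemma exists_radius_event {d n k : ℕ} (hk : 1 ≤ k) (hkn : k ≤ n)
    {C : Set (EuclideanSpace ℝ (Fin d))} (ν : Measure (EuclideanSpace ℝ (Fin d) × ℝ))
    [IsProbabilityMeasure ν] (hCν : ν.fst Cᶜ = 0) {r p : ℝ}
    (hball : ∀ y ∈ C, ENNReal.ofReal p ≤ ν.fst (Metric.closedBall y r))
    (hnp : 4 * k ≤ n * p) :
    ∃ B : Set (Fin n → EuclideanSpace ℝ (Fin d) × ℝ), MeasurableSet B ∧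
      Measure.pi (fun _ : Fin n => ν) B ≤ ENNReal.ofReal (n * Real.exp (-k)) ∧
      ∀ D, D ∉ B → ∀ x ∈ C, ∀ i ∈ nearestSet k (fun j => (D j).1) x, ‖(D i).1 - x‖ ≤ 2 * r := by
  have hn0 : (0 : ℝ) < n := by exact_mod_cast (by omega : 0 < n)
  have hk1 : (1 : ℝ) ≤ k := by exact_mod_cast hk
  -- A Chernoff functional averaged over centres y, in place of a union bound over a net of C. Its
  -- expectation is at most exp(k − np/2) ≤ exp(-k).
  let J : (Fin n → EuclideanSpace ℝ (Fin d) × ℝ) → ℝ≥0∞ := fun D =>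
    ∫⁻ y, ENNReal.ofReal (Real.exp k) * expNegCount r y D ∂ν.fst
  have hjoint := (measurable_expNegCount (d := d) (n := n) r).const_mul
    (ENNReal.ofReal (Real.exp k))
  have hJm : Measurable J := hjoint.lintegral_prod_left'
  have hJint : ∫⁻ D, J D ∂Measure.pi (fun _ : Fin n => ν) ≤ ENNReal.ofReal (Real.exp (-k)) := by
    have hswap : AEMeasurable (Function.uncurry
        fun (D : Fin n → EuclideanSpace ℝ (Fin d) × ℝ) (y : EuclideanSpace ℝ (Fin d)) =>
          ENNReal.ofReal (Real.exp k) * expNegCount r y D)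
        ((Measure.pi fun _ : Fin n => ν).prod ν.fst) :=
      (hjoint.comp measurable_swap).aemeasurable
    rw [lintegral_lintegral_swap hswap]
    have hae : ∀ᵐ y ∂ν.fst, ∫⁻ D, ENNReal.ofReal (Real.exp k) * expNegCount r y D
        ∂Measure.pi (fun _ : Fin n => ν) ≤ ENNReal.ofReal (Real.exp (-k)) := by
      have hC' : ∀ᵐ y ∂ν.fst, y ∈ C := hCν
      filter_upwards [hC'] with y hy
      rw [lintegral_const_mul' _ _ ENNReal.ofReal_ne_top]
      refine (mul_le_mul_right (lintegral_expNegCount_le ν (hball y hy)) _).trans ?_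
      rw [← ENNReal.ofReal_mul (Real.exp_pos _).le, ← Real.exp_add]
      refine ENNReal.ofReal_le_ofReal (Real.exp_le_exp.2 ?_)
      linarith
    refine (lintegral_mono_ae hae).trans (le_of_eq ?_)
    simp
  -- Markov's inequality loses 1/p, which is at most n since np ≥ 4k ≥ 1.
  refine ⟨{D | ENNReal.ofReal p ≤ J D}, measurableSet_le measurable_const hJm, ?_, ?_⟩
  · have hmarkov := (mul_meas_ge_le_lintegral hJm (ENNReal.ofReal p)
      (μ := Measure.pi fun _ : Fin n => ν)).trans hJint
    have h1 : 1 ≤ n * p := by linarith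
    calc Measure.pi (fun _ : Fin n => ν) {D | ENNReal.ofReal p ≤ J D}
        ≤ ENNReal.ofReal (n * p) * Measure.pi (fun _ : Fin n => ν) {D | ENNReal.ofReal p ≤ J D} :=
          le_mul_of_one_le_left zero_le (ENNReal.one_le_ofReal.2 h1)
      _ = ENNReal.ofReal n * (ENNReal.ofReal p *
            Measure.pi (fun _ : Fin n => ν) {D | ENNReal.ofReal p ≤ J D}) := by
          rw [ENNReal.ofReal_mul hn0.le, mul_assoc]
      _ ≤ ENNReal.ofReal n * ENNReal.ofReal (Real.exp (-k)) := by gcongr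
      _ = _ := by rw [ENNReal.ofReal_mul hn0.le]
  · intro D hD x hx i hi
    by_contra hlt
    push Not at hlt
    apply hD
    -- A neighbour of x farther than 2r leaves at most k points within 2r of x, hence at most k
    -- within r of any y in the ball B(x, r). The integrand of J is then at least 1 on a ball of
    -- mass at least p.
    have hcount : ∀ y ∈ Metric.closedBall x r,
        (Finset.univ.filter fun i => ‖(D i).1 - y‖ ≤ r).card ≤ k := by
      intro y hy
      have hsub : (Finset.univ.filter fun i => ‖(D i).1 - y‖ ≤ r) ⊆
          Finset.univ.filter fun i => ‖(D i).1 - x‖ ≤ 2 * r := by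
        intro j hj
        simp only [Finset.mem_filter, Finset.mem_univ, true_and] at hj ⊢
        have h1 : ‖y - x‖ ≤ r := by rwa [Metric.mem_closedBall, dist_eq_norm] at hy
        have h2 := norm_add_le ((D j).1 - y) (y - x)
        rw [sub_add_sub_cancel] at h2
        linarith
      refine (Finset.card_le_card hsub).trans ?_
      by_contra! h
      exact absurd (norm_sub_le_of_mem_nearestSet (X := fun j => (D j).1) hkn h.le hi)
        (not_le.2 hlt)
    change ENNReal.ofReal p ≤ J D
    calc ENNReal.ofReal p ≤ ν.fst (Metric.closedBall x r) := hball x hx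
      _ = ∫⁻ _ in Metric.closedBall x r, 1 ∂ν.fst := by rw [setLIntegral_const, one_mul]
      _ ≤ ∫⁻ y in Metric.closedBall x r, ENNReal.ofReal (Real.exp k) * expNegCount r y D ∂ν.fst :=
          setLIntegral_mono' Metric.isClosed_closedBall.measurableSet fun y hy =>
            one_le_exp_mul_expNegCount (hcount y hy)
      _ ≤ J D := setLIntegral_le_lintegral _ _

/-- All moments of the largest distance from a point of `C` to one of its `k` nearest neighbours
are of the order of the rate. -/
lemma exists_radius_div_rate_le {d : ℕ} (hd : 1 ≤ d) {C : Set (EuclideanSpace ℝ (Fin d))}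
    (hC : IsCompact C) (hCreg : IsRegularSet C) {μmin : ℝ} (hμ : 0 < μmin) {a b : ℝ}
    (ha : 0 < a) (hab : a ≤ b) (m : ℕ) :
    ∃ K : ℝ, 0 ≤ K ∧
      ∀ (ν : Measure (EuclideanSpace ℝ (Fin d) × ℝ)) [IsProbabilityMeasure ν],
      StrongDensity ν.fst C μmin →
      ∀ n k : ℕ, 2 ≤ n → k ≤ n → a * (n : ℝ) ^ (2 / ((d : ℝ) + 2)) ≤ (k : ℝ) →
      (k : ℝ) ≤ b * (n : ℝ) ^ (2 / ((d : ℝ) + 2)) →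
      ∃ R : (Fin n → EuclideanSpace ℝ (Fin d) × ℝ) → ℝ, Measurable R ∧ (∀ D, 0 ≤ R D) ∧
        (∀ D, (∀ i, (D i).1 ∈ C) → ∀ x ∈ C, ∀ i ∈ nearestSet k (fun j => (D j).1) x,
          ‖(D i).1 - x‖ ≤ R D) ∧
        ∫⁻ D, ENNReal.ofReal ((R D / knnRate d n) ^ m) ∂Measure.pi (fun _ : Fin n => ν) ≤
          ENNReal.ofReal K := by
  obtain ⟨c, R₀, hc, hR₀, hdiam, hmass⟩ := exists_le_measure_closedBall hC hCreg hμ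
  have hb : 0 < b := ha.trans_le hab
  have hd0 : d ≠ 0 := by omega
  set B : ℝ := (4 * b / c) ^ (d : ℝ)⁻¹ with hB
  have hB0 : 0 < B := by positivity
  have hBd : B ^ d = 4 * b / c := Real.rpow_inv_natCast_pow (by positivity) hd0
  -- In terms of t = n^(1/(d+2)), the bad event contributes at most a constant times t^m · n ·
  -- exp(-k), with n = t^(d+2). The bound exp(-k) ≤ j!/k^j together with k ≥ a t cancels all these
  -- powers.
  set j := m + d + 2 with hj
  refine ⟨(4 * B) ^ m + (3 * R₀) ^ m * (2 ^ m * (j.factorial / a ^ j)), by positivity, ?_⟩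
  intro ν _ hν n k hn hkn hak hkb
  have hk := one_le_of_mul_rpow_le hn ha hak
  have hk0 : (0 : ℝ) < k := by exact_mod_cast hk
  have hn0 : (0 : ℝ) < n := by exact_mod_cast (by omega : 0 < n)
  have hn1 : (1 : ℝ) ≤ n := by exact_mod_cast (by omega : 1 ≤ n)
  set t : ℝ := (n : ℝ) ^ (1 / ((d : ℝ) + 2)) with ht
  have ht1 : 1 ≤ t := Real.one_le_rpow hn1 (by positivity)
  have ht0 : 0 < t := by linarith
  have htn : t ^ (d + 2) = n := by
    rw [ht, ← Real.rpow_natCast, ← Real.rpow_mul hn0.le,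
      show 1 / ((d : ℝ) + 2) * ((d + 2 : ℕ) : ℝ) = 1 by push_cast; field_simp, Real.rpow_one]
  have ht2 : (n : ℝ) ^ (2 / ((d : ℝ) + 2)) = t ^ 2 := by
    rw [ht, ← Real.rpow_natCast, ← Real.rpow_mul hn0.le]
    congr 1
    push_cast
    ring
  rw [ht2] at hak hkb
  have hδ : knnRate d n = Real.log n * t⁻¹ := by
    rw [knnRate, Real.rpow_neg hn0.le]
  have hδ0 : 0 < knnRate d n := knnRate_pos hn
  have hδt : t⁻¹ / knnRate d n ≤ 2 := by
    have hL := half_le_log hn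
    rw [hδ, div_le_iff₀ (by positivity)]
    have : 0 < t⁻¹ := by positivity
    nlinarith
  -- The solution of n · c r^d = 4k, the threshold in `exists_radius_event`.
  set r : ℝ := (4 * k / (c * n)) ^ (d : ℝ)⁻¹ with hr
  have hr0 : 0 < r := by positivity
  have hrd : r ^ d = 4 * k / (c * n) := Real.rpow_inv_natCast_pow (by positivity) hd0
  have hrB : r ≤ B * t⁻¹ := by
    refine le_of_pow_le_pow_left₀ hd0 (by positivity) ?_
    rw [hrd, mul_pow, hBd, ← htn, pow_add, inv_pow, div_mul_eq_mul_div, ← div_eq_mul_inv, div_div,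
      div_le_div_iff₀ (by positivity) (by positivity)]
    have : 0 ≤ c * t ^ d := by positivity
    nlinarith
  have hrδ : 2 * r / knnRate d n ≤ 4 * B := by
    calc 2 * r / knnRate d n ≤ 2 * (B * t⁻¹) / knnRate d n := by gcongr
      _ = 2 * B * (t⁻¹ / knnRate d n) := by ring
      _ ≤ 2 * B * 2 := by gcongr
      _ = 4 * B := by ring
  -- The mass bound holds only up to R₀. For larger r the bound on distances within C already
  -- suffices.
  rcases lt_or_ge R₀ r with hlt | hle
  · refine ⟨fun _ => 2 * r, measurable_const, fun _ => by positivity, fun D hD x hx i _ =>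
      (hdiam _ (hD i) _ hx).trans (by linarith), ?_⟩
    rw [lintegral_const, measure_univ, mul_one]
    refine ENNReal.ofReal_le_ofReal ?_
    have : (2 * r / knnRate d n) ^ m ≤ (4 * B) ^ m := by gcongr
    have : 0 ≤ (3 * R₀) ^ m * (2 ^ m * (j.factorial / a ^ j)) := by positivity
    linarith
  · obtain ⟨S, hSm, hS, hSD⟩ := exists_radius_event hk hkn ν hν.1 (r := r) (p := c * r ^ d)
      (fun y hy => hmass _ hν y hy r hr0 hle) (by
        rw [hrd]
        refine le_of_eq ?_
        field_simp)
    refine ⟨fun D => 2 * r + S.indicator (fun _ => R₀) D,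
      measurable_const.add (measurable_const.indicator hSm),
      fun D => add_nonneg (by positivity) (Set.indicator_nonneg (fun _ _ => hR₀.le) D),
      fun D hD x hx i hi => ?_, ?_⟩
    · change _ ≤ 2 * r + S.indicator (fun _ => R₀) D
      by_cases hDS : D ∈ S
      · rw [Set.indicator_of_mem hDS]
        linarith [hdiam _ (hD i) _ hx]
      · rw [Set.indicator_of_notMem hDS, add_zero]
        exact hSD D hDS x hx i hi
    have hpt : ∀ D, ENNReal.ofReal (((2 * r + S.indicator (fun _ => R₀) D) / knnRate d n) ^ m) ≤
        ENNReal.ofReal ((4 * B) ^ m) +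
          S.indicator (fun _ => ENNReal.ofReal ((3 * R₀ / knnRate d n) ^ m)) D := by
      intro D
      by_cases hDS : D ∈ S
      · rw [Set.indicator_of_mem hDS, Set.indicator_of_mem hDS]
        refine le_add_left (ENNReal.ofReal_le_ofReal ?_)
        gcongr
        linarith
      · rw [Set.indicator_of_notMem hDS, Set.indicator_of_notMem hDS, add_zero, add_zero]
        exact ENNReal.ofReal_le_ofReal (by gcongr)
    refine (lintegral_mono hpt).trans ?_
    rw [lintegral_add_left measurable_const, lintegral_const, measure_univ, mul_one,
      lintegral_indicator_const hSm]
    rw [ENNReal.ofReal_add (by positivity) (by positivity)]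
    gcongr
    refine (mul_le_mul_right hS _).trans ?_
    rw [← ENNReal.ofReal_mul (by positivity)]
    refine ENNReal.ofReal_le_ofReal ?_
    have h1 : 3 * R₀ / knnRate d n ≤ 3 * R₀ * (2 * t) := by
      rw [div_eq_mul_inv]
      gcongr
      have : t⁻¹ / knnRate d n * t ≤ 2 * t := by gcongr
      calc (knnRate d n)⁻¹ = t⁻¹ / knnRate d n * t := by field_simp
        _ ≤ 2 * t := this
    have h2 : Real.exp (-k) ≤ j.factorial / (a ^ j * t ^ j) := by
      have h3 := Real.pow_div_factorial_le_exp k hk0.le j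
      have h4 : a ^ j * t ^ j ≤ (k : ℝ) ^ j := by
        rw [← mul_pow]
        refine pow_le_pow_left₀ (by positivity) (le_trans ?_ hak) j
        gcongr
        nlinarith
      rw [Real.exp_neg, inv_le_comm₀ (Real.exp_pos _) (by positivity), inv_div]
      refine le_trans ?_ h3
      gcongr
    calc (3 * R₀ / knnRate d n) ^ m * (n * Real.exp (-k))
        ≤ (3 * R₀ * (2 * t)) ^ m * (n * (j.factorial / (a ^ j * t ^ j))) := by gcongr
      _ = (3 * R₀) ^ m * (2 ^ m * (j.factorial / a ^ j)) := by
        rw [← htn, hj, mul_pow (3 * R₀) (2 * t) m, mul_pow 2 t m, add_assoc m d 2, pow_add t m (d + 2)]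
        field_simp

/-! ### Moments of the noise and of its centred square -/

/-- Moments of a random variable with a finite two-sided exponential moment. -/
lemma lintegral_abs_pow_le_of_exp {κ : Measure ℝ} {c₀ s : ℝ} (hc₀ : 0 < c₀)
    (h : ∀ t : ℝ, |t| ≤ 1 / c₀ → ∫⁻ y, ENNReal.ofReal (Real.exp (t * (y - s))) ∂κ ≤
      ENNReal.ofReal (Real.exp (c₀ ^ 2 * t ^ 2))) (m : ℕ) :
    ∫⁻ y, ENNReal.ofReal (|y - s| ^ m) ∂κ ≤
      ENNReal.ofReal (c₀ ^ m * m.factorial * (2 * Real.exp 1)) := by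
  -- Only the extreme values t = ±1/c₀ are used; each gives the bound e.
  have h1 := h (1 / c₀) (by rw [abs_of_pos (by positivity)])
  have h2 := h (-(1 / c₀)) (by rw [abs_neg, abs_of_pos (by positivity)])
  have e1 : c₀ ^ 2 * (1 / c₀) ^ 2 = 1 := by field_simp
  have e2 : c₀ ^ 2 * (-(1 / c₀)) ^ 2 = 1 := by rw [neg_sq]; exact e1
  rw [e1] at h1
  rw [e2] at h2
  have hpt : ∀ y, ENNReal.ofReal (|y - s| ^ m) ≤ ENNReal.ofReal (c₀ ^ m * m.factorial) *
      (ENNReal.ofReal (Real.exp (1 / c₀ * (y - s))) +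
        ENNReal.ofReal (Real.exp (-(1 / c₀) * (y - s)))) := by
    intro y
    rw [← ENNReal.ofReal_add (Real.exp_pos _).le (Real.exp_pos _).le,
      ← ENNReal.ofReal_mul (by positivity)]
    refine ENNReal.ofReal_le_ofReal ?_
    have h3 := Real.pow_div_factorial_le_exp (1 / c₀ * |y - s|) (by positivity) m
    rw [div_le_iff₀ (by positivity), mul_pow, one_div_pow, one_div_mul_eq_div,
      div_le_iff₀ (by positivity)] at h3
    have h4 : Real.exp (1 / c₀ * |y - s|) ≤
        Real.exp (1 / c₀ * (y - s)) + Real.exp (-(1 / c₀) * (y - s)) := by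
      rcases abs_cases (y - s) with ⟨h, -⟩ | ⟨h, -⟩
      · rw [h]; linarith [Real.exp_pos (-(1 / c₀) * (y - s))]
      · rw [h, mul_neg, ← neg_mul]; linarith [Real.exp_pos (1 / c₀ * (y - s))]
    have h5 := mul_le_mul_of_nonneg_left h4 (show 0 ≤ c₀ ^ m * (m.factorial : ℝ) by positivity)
    linarith
  refine (lintegral_mono hpt).trans ?_
  rw [lintegral_const_mul' _ _ ENNReal.ofReal_ne_top, lintegral_add_left (by fun_prop)]
  refine (mul_le_mul_right (add_le_add h1 h2) _).trans (le_of_eq ?_)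
  rw [← ENNReal.ofReal_add (Real.exp_pos _).le (Real.exp_pos _).le,
    ← ENNReal.ofReal_mul (by positivity)]
  congr 1
  ring

lemma integrable_and_integral_le_of_lintegral_le {κ : Measure ℝ} {h : ℝ → ℝ} (hm : Measurable h)
    (h0 : ∀ y, 0 ≤ h y) {V : ℝ} (hV : 0 ≤ V)
    (hle : ∫⁻ y, ENNReal.ofReal (h y) ∂κ ≤ ENNReal.ofReal V) :
    Integrable h κ ∧ ∫ y, h y ∂κ ≤ V := by
  refine ⟨⟨hm.aestronglyMeasurable, ?_⟩, ?_⟩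
  · rw [hasFiniteIntegral_iff_ofReal (ae_of_all _ h0)]
    exact hle.trans_lt ENNReal.ofReal_lt_top
  · rw [integral_eq_lintegral_of_nonneg_ae (ae_of_all _ h0) hm.aestronglyMeasurable]
    exact ENNReal.toReal_le_of_le_ofReal hV hle

lemma lintegral_le_of_ae_condKernel_le {E : Type*} [MeasurableSpace E] (ν : Measure (E × ℝ))
    [IsProbabilityMeasure ν] {h : E × ℝ → ℝ≥0∞} (hh : Measurable h) {H : ℝ≥0∞}
    (hH : ∀ᵐ x ∂ν.fst, ∫⁻ y, h (x, y) ∂ν.condKernel x ≤ H) : ∫⁻ z, h z ∂ν ≤ H := by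
  simpa using lintegral_fst_mul_le ν (φ := 1) measurable_one hh hH

/-- All moments of the largest mean of the noise over the nearest neighbours are of the order of
the rate. -/
lemma exists_lintegral_nearestSup_noise_le (d : ℕ) {a c₀ : ℝ} (ha : 0 < a) (hc₀ : 0 < c₀) (m : ℕ) :
    ∃ K : ℝ, 0 ≤ K ∧ ∀ (C : Set (EuclideanSpace ℝ (Fin d))), IsCompact C →
      ∀ (f : EuclideanSpace ℝ (Fin d) → ℝ), Measurable f →
      ∀ (ν : Measure (EuclideanSpace ℝ (Fin d) × ℝ)) [IsProbabilityMeasure ν],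
      IsRegressionFunction ν f → UniformNoise ν f c₀ →
      ∀ n k : ℕ, 2 ≤ n → k ≤ n → a * (n : ℝ) ^ (2 / ((d : ℝ) + 2)) ≤ (k : ℝ) →
      ∫⁻ D, ENNReal.ofReal ((nearestSup k C (fun z => z.2 - f z.1) D / knnRate d n) ^ m)
        ∂Measure.pi (fun _ : Fin n => ν) ≤ ENNReal.ofReal K := by
  let A : ℕ → ℝ := fun j => c₀ ^ j * j.factorial * (2 * Real.exp 1)
  have hA : ∀ j, 0 ≤ A j := fun j => by positivity
  obtain ⟨K, hK, h⟩ := exists_lintegral_nearestSup_div_rate_le d ha (hA 2) A hA m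
  refine ⟨K, hK, fun C hC f hf ν _ hreg hnoise => h C hC ν _ (by fun_prop) ?_ ?_ ?_⟩
  · refine hreg.mono fun x hx => ⟨hx.1.sub (integrable_const (f x)), ?_⟩
    change ∫ y, (y - f x) ∂ν.condKernel x = 0
    rw [integral_sub hx.1 (integrable_const _), hx.2]
    simp
  · refine hnoise.mono fun x hx => ?_
    refine integrable_and_integral_le_of_lintegral_le (by fun_prop) (fun _ => sq_nonneg _) (hA 2) ?_
    simpa only [sq_abs] using lintegral_abs_pow_le_of_exp hc₀ hx 2
  · intro j
    refine lintegral_le_of_ae_condKernel_le ν (by fun_prop) (hnoise.mono fun x hx => ?_)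
    exact lintegral_abs_pow_le_of_exp hc₀ hx j

/-- All moments of the largest mean of the centred squared noise over the nearest neighbours are of
the order of the rate. -/
lemma exists_lintegral_nearestSup_sq_noise_le (d : ℕ) {a c₀ B : ℝ} (ha : 0 < a) (hc₀ : 0 < c₀)
    (hB : 0 ≤ B) (m : ℕ) :
    ∃ K : ℝ, 0 ≤ K ∧ ∀ (C : Set (EuclideanSpace ℝ (Fin d))), IsCompact C →
      ∀ (f v : EuclideanSpace ℝ (Fin d) → ℝ), Measurable f → Measurable v →
      (∀ x ∈ C, |v x| ≤ B) →
      ∀ (ν : Measure (EuclideanSpace ℝ (Fin d) × ℝ)) [IsProbabilityMeasure ν], ν.fst Cᶜ = 0 →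
      IsConditionalVariance ν f v → UniformNoise ν f c₀ →
      ∀ n k : ℕ, 2 ≤ n → k ≤ n → a * (n : ℝ) ^ (2 / ((d : ℝ) + 2)) ≤ (k : ℝ) →
      ∫⁻ D, ENNReal.ofReal
        ((nearestSup k C (fun z => (z.2 - f z.1) ^ 2 - v z.1) D / knnRate d n) ^ m)
        ∂Measure.pi (fun _ : Fin n => ν) ≤ ENNReal.ofReal K := by
  let A₀ : ℕ → ℝ := fun j => c₀ ^ j * j.factorial * (2 * Real.exp 1)
  have hA₀ : ∀ j, 0 ≤ A₀ j := fun j => by positivity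
  -- From convexity: |e² − v|^j ≤ 2^(j-1) (|e|^(2j) + B^j).
  let A : ℕ → ℝ := fun j => 2 ^ (j - 1) * (A₀ (2 * j) + B ^ j)
  have hA : ∀ j, 0 ≤ A j := fun j => mul_nonneg (by positivity) (add_nonneg (hA₀ _) (by positivity))
  obtain ⟨K, hK, h⟩ := exists_lintegral_nearestSup_div_rate_le d ha (hA 2) A hA m
  refine ⟨K, hK, fun C hC f v hf hv hvB ν _ hCν hvar hnoise => ?_⟩
  have hmom : ∀ j, ∀ᵐ x ∂ν.fst, ∫⁻ y, ENNReal.ofReal (|(y - f x) ^ 2 - v x| ^ j) ∂ν.condKernel x ≤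
      ENNReal.ofReal (A j) := by
    intro j
    have hC' : ∀ᵐ x ∂ν.fst, x ∈ C := hCν
    filter_upwards [hnoise, hC'] with x hx hxC
    have hpt : ∀ y, ENNReal.ofReal (|(y - f x) ^ 2 - v x| ^ j) ≤ ENNReal.ofReal (2 ^ (j - 1)) *
        (ENNReal.ofReal (|y - f x| ^ (2 * j)) + ENNReal.ofReal (B ^ j)) := by
      intro y
      rw [← ENNReal.ofReal_add (by positivity) (by positivity), ← ENNReal.ofReal_mul (by positivity)]
      refine ENNReal.ofReal_le_ofReal ?_
      have h1 : |(y - f x) ^ 2 - v x| ≤ |y - f x| ^ 2 + B := by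
        refine (abs_sub _ _).trans ?_
        rw [abs_pow]
        gcongr
        exact hvB x hxC
      calc |(y - f x) ^ 2 - v x| ^ j ≤ (|y - f x| ^ 2 + B) ^ j := by gcongr
        _ ≤ 2 ^ (j - 1) * ((|y - f x| ^ 2) ^ j + B ^ j) := add_pow_le (by positivity) hB j
        _ = _ := by rw [pow_mul]
    refine (lintegral_mono hpt).trans ?_
    rw [lintegral_const_mul' _ _ ENNReal.ofReal_ne_top, lintegral_add_right _ measurable_const,
      lintegral_const, measure_univ, mul_one, ENNReal.ofReal_mul (by positivity),
      ENNReal.ofReal_add (hA₀ _) (by positivity)]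
    gcongr
    exact lintegral_abs_pow_le_of_exp hc₀ hx (2 * j)
  refine h C hC ν _ (by fun_prop) ?_ ?_ ?_
  · refine hvar.mono fun x hx => ⟨hx.1.sub (integrable_const (v x)), ?_⟩
    change ∫ y, ((y - f x) ^ 2 - v x) ∂ν.condKernel x = 0
    rw [integral_sub hx.1 (integrable_const _), hx.2]
    simp
  · refine (hmom 2).mono fun x hx => ?_
    refine integrable_and_integral_le_of_lintegral_le (by fun_prop) (fun _ => sq_nonneg _) (hA 2) ?_
    simpa only [sq_abs] using hx
  · intro j
    exact lintegral_le_of_ae_condKernel_le ν (by fun_prop) (hmom j)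

/-! ### Deterministic error decomposition -/

lemma abs_mean_le_of_forall_abs_le {ι : Type*} {S : Finset ι} {k : ℕ} (hk : 1 ≤ k)
    (hS : S.card = k) {F : ι → ℝ} {B : ℝ} (h : ∀ i ∈ S, |F i| ≤ B) :
    |(1 / (k : ℝ)) * ∑ i ∈ S, F i| ≤ B := by
  have hk0 : (0 : ℝ) < k := by exact_mod_cast hk
  rw [abs_mul, abs_of_pos (by positivity : (0 : ℝ) < 1 / k), one_div, inv_mul_le_iff₀ hk0, ← hS,
    ← nsmul_eq_mul]
  exact (Finset.abs_sum_le_sum_abs _ _).trans (Finset.sum_le_card_nsmul _ _ _ h)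

/-- Noise plus bias: the bias averages f(X_i) − f(x) over neighbours at distance at most R. -/
lemma abs_knnRegression_sub_le {d n k : ℕ} (hk : 1 ≤ k) (hkn : k ≤ n)
    {C : Set (EuclideanSpace ℝ (Fin d))} {f : EuclideanSpace ℝ (Fin d) → ℝ} {L : NNReal}
    (hf : LipschitzWith L f) (D : Fin n → EuclideanSpace ℝ (Fin d) × ℝ)
    {x : EuclideanSpace ℝ (Fin d)} (hx : x ∈ C) {R : ℝ}
    (hR : ∀ i ∈ nearestSet k (fun j => (D j).1) x, ‖(D i).1 - x‖ ≤ R) :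
    |knnRegression k D x - f x| ≤ nearestSup k C (fun z => z.2 - f z.1) D + L * R := by
  have hk0 : (0 : ℝ) < k := by exact_mod_cast hk
  have hS := card_nearestSet hkn (fun j => (D j).1) x
  have h1 := abs_mean_le_nearestSup (k := k) (fun z => z.2 - f z.1) D hx
  have h2 : |(1 / (k : ℝ)) * ∑ i ∈ nearestSet k (fun j => (D j).1) x, (f (D i).1 - f x)| ≤
      L * R := by
    refine abs_mean_le_of_forall_abs_le hk hS fun i hi => ?_
    have := hf.norm_sub_le (D i).1 x
    rw [Real.norm_eq_abs] at this
    exact this.trans (by gcongr; exact hR i hi)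
  have e : knnRegression k D x - f x =
      (1 / (k : ℝ)) * ∑ i ∈ nearestSet k (fun j => (D j).1) x, ((D i).2 - f (D i).1) +
      (1 / (k : ℝ)) * ∑ i ∈ nearestSet k (fun j => (D j).1) x, (f (D i).1 - f x) := by
    rw [knnRegression, sum_neighborOrder k D x fun i => (D i).2, ← mul_add,
      ← Finset.sum_add_distrib]
    simp only [sub_add_sub_cancel]
    rw [Finset.sum_sub_distrib, Finset.sum_const, hS, nsmul_eq_mul]
    field_simp
  rw [e]
  exact (abs_add_le _ _).trans (add_le_add h1 h2)

/-- Deterministic bound for the error of the variance estimator by the suprema of the means of the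
noise and of the centred squared noise and by the nearest-neighbour radius. -/
lemma abs_knnVariance_sub_le {d n k : ℕ} (hk : 1 ≤ k) (hkn : k ≤ n)
    {C : Set (EuclideanSpace ℝ (Fin d))} {f v : EuclideanSpace ℝ (Fin d) → ℝ} {Lf Lv : NNReal}
    (hf : LipschitzWith Lf f) (hv : LipschitzWith Lv v) {B : ℝ} (hB : ∀ x ∈ C, |v x| ≤ B)
    (D : Fin n → EuclideanSpace ℝ (Fin d) × ℝ) (hD : ∀ i, (D i).1 ∈ C) {R : ℝ}
    (hR : ∀ x ∈ C, ∀ i ∈ nearestSet k (fun j => (D j).1) x, ‖(D i).1 - x‖ ≤ R)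
    {x : EuclideanSpace ℝ (Fin d)} (hx : x ∈ C) :
    |knnVariance k D x - v x| ≤
      nearestSup k C (fun z => (z.2 - f z.1) ^ 2 - v z.1) D + Lv * R +
      (nearestSup k C (fun z => z.2 - f z.1) D + Lf * R) *
        (1 + B + nearestSup k C (fun z => (z.2 - f z.1) ^ 2 - v z.1) D) +
      (nearestSup k C (fun z => z.2 - f z.1) D + Lf * R) ^ 2 := by
  have hk0 : (0 : ℝ) < k := by exact_mod_cast hk
  set S := nearestSet k (fun j => (D j).1) x with hSdef
  have hS : S.card = k := card_nearestSet hkn (fun j => (D j).1) x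
  have hT1 := abs_mean_le_nearestSup (k := k) (fun z => (z.2 - f z.1) ^ 2 - v z.1) D hx
  rw [← hSdef] at hT1
  set T₁ := nearestSup k C (fun z => (z.2 - f z.1) ^ 2 - v z.1) D with hT₁
  set Δ := nearestSup k C (fun z => z.2 - f z.1) D + Lf * R with hΔ
  have hη : ∀ i, |f (D i).1 - knnRegression k D (D i).1| ≤ Δ := by
    intro i
    rw [abs_sub_comm]
    exact abs_knnRegression_sub_le hk hkn hf D (hD i) (hR _ (hD i))
  have hmean : ∀ c : ℝ, (1 / (k : ℝ)) * ∑ _i ∈ S, c = c := by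
    intro c
    rw [Finset.sum_const, hS, nsmul_eq_mul]
    field_simp
  let e : Fin n → ℝ := fun i => (D i).2 - f (D i).1
  let η : Fin n → ℝ := fun i => f (D i).1 - knnRegression k D (D i).1
  -- The residual is e + η, and the expansion of its square isolates the mean of the centred squared
  -- noise.
  have h1 : knnVariance k D x - v x =
      (1 / (k : ℝ)) * ∑ i ∈ S, (e i ^ 2 - v (D i).1) +
      (1 / (k : ℝ)) * ∑ i ∈ S, (v (D i).1 - v x + 2 * e i * η i + η i ^ 2) := by
    rw [knnVariance, sum_neighborOrder k D x fun i =>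
      ((D i).2 - knnRegression k D (D i).1) ^ 2, ← hSdef, ← mul_add, ← Finset.sum_add_distrib]
    nth_rewrite 1 [← hmean (v x)]
    rw [← mul_sub, ← Finset.sum_sub_distrib]
    congr 1
    refine Finset.sum_congr rfl fun i _ => ?_
    simp only [e, η]
    ring
  have h2 : |(1 / (k : ℝ)) * ∑ i ∈ S, (v (D i).1 - v x + 2 * e i * η i + η i ^ 2)| ≤
      (1 / (k : ℝ)) * ∑ i ∈ S, (Δ * (e i ^ 2 - v (D i).1) +
        (Lv * R + Δ * (1 + B) + Δ ^ 2)) := by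
    rw [abs_mul, abs_of_pos (by positivity : (0 : ℝ) < 1 / k)]
    gcongr
    refine (Finset.abs_sum_le_sum_abs _ _).trans (Finset.sum_le_sum fun i hi => ?_)
    have b1 : |v (D i).1 - v x| ≤ Lv * R := by
      have := hv.norm_sub_le (D i).1 x
      rw [Real.norm_eq_abs] at this
      exact this.trans (by gcongr; exact hR x hx i hi)
    -- Using 2|e| ≤ 1 + e² keeps the cross term within the quantities at hand: the mean of e² is at
    -- most B plus the supremum of the means of e² − v.
    have b2 : |2 * e i * η i| ≤ (1 + e i ^ 2) * Δ := by
      rw [abs_mul]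
      refine mul_le_mul ?_ (hη i) (abs_nonneg _) (by positivity)
      rw [abs_le]
      constructor <;> nlinarith [sq_nonneg (e i - 1), sq_nonneg (e i + 1)]
    have hΔ0 : 0 ≤ Δ := (abs_nonneg _).trans (hη i)
    have b3 : |η i ^ 2| ≤ Δ ^ 2 := by
      rw [abs_pow]
      exact pow_le_pow_left₀ (abs_nonneg _) (hη i) 2
    have b4 : v (D i).1 * Δ ≤ B * Δ :=
      mul_le_mul_of_nonneg_right ((le_abs_self _).trans (hB _ (hD i))) hΔ0
    have b5 := abs_add_three (v (D i).1 - v x) (2 * e i * η i) (η i ^ 2)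
    linarith
  have h3 : (1 / (k : ℝ)) * ∑ i ∈ S, (Δ * (e i ^ 2 - v (D i).1) +
        (Lv * R + Δ * (1 + B) + Δ ^ 2)) =
      Δ * ((1 / (k : ℝ)) * ∑ i ∈ S, (e i ^ 2 - v (D i).1)) +
        (Lv * R + Δ * (1 + B) + Δ ^ 2) := by
    rw [Finset.sum_add_distrib, mul_add, hmean, ← Finset.mul_sum]
    ring
  obtain ⟨i₀, -⟩ : S.Nonempty := by
    rw [← Finset.card_pos, hS]
    omega
  have hΔ0 : 0 ≤ Δ := (abs_nonneg _).trans (hη i₀)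
  have h4 : Δ * ((1 / (k : ℝ)) * ∑ i ∈ S, (e i ^ 2 - v (D i).1)) ≤ Δ * T₁ :=
    mul_le_mul_of_nonneg_left ((le_abs_self _).trans hT1) hΔ0
  rw [h1]
  refine (abs_add_le _ _).trans ?_
  rw [h3] at h2
  have h5 : |(1 / (k : ℝ)) * ∑ i ∈ S, (e i ^ 2 - v (D i).1)| ≤ T₁ := hT1
  linarith

/-! ### Rescaling by the rate and conclusion -/

lemma one_add_add_add_pow_le {x y z : ℝ} (hx : 0 ≤ x) (hy : 0 ≤ y) (hz : 0 ≤ z) (N : ℕ) :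
    (1 + x + y + z) ^ N ≤ 4 ^ N * (1 + x ^ N + y ^ N + z ^ N) := by
  have key : ∀ M : ℝ, 1 ≤ M → x ≤ M → y ≤ M → z ≤ M → M ^ N ≤ 1 + x ^ N + y ^ N + z ^ N →
      (1 + x + y + z) ^ N ≤ 4 ^ N * (1 + x ^ N + y ^ N + z ^ N) := by
    intro M h1 h2 h3 h4 h5
    calc (1 + x + y + z) ^ N ≤ (4 * M) ^ N := by gcongr; linarith
      _ = 4 ^ N * M ^ N := mul_pow _ _ _
      _ ≤ _ := by gcongr
  have px : 0 ≤ x ^ N := by positivity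
  have py : 0 ≤ y ^ N := by positivity
  have pz : 0 ≤ z ^ N := by positivity
  refine key (max (max 1 x) (max y z)) (by simp) (by simp) (by simp) (by simp) ?_
  rcases max_choice (max 1 x) (max y z) with h | h <;> rw [h]
  · rcases max_choice 1 x with h | h <;> rw [h]
    · rw [one_pow]; linarith
    · linarith
  · rcases max_choice y z with h | h <;> rw [h] <;> linarith

lemma knnRate_le {d n : ℕ} (hn : 2 ≤ n) : knnRate d n ≤ d + 2 := by
  have hn0 : (0 : ℝ) < n := by exact_mod_cast (by omega : 0 < n)
  have h := Real.log_le_rpow_div hn0.le (ε := 1 / ((d : ℝ) + 2)) (by positivity)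
  rw [knnRate, Real.rpow_neg hn0.le, ← div_eq_mul_inv, div_le_iff₀ (by positivity)]
  refine h.trans (le_of_eq ?_)
  field_simp

lemma knnRate_rpow {d n : ℕ} (hn : 2 ≤ n) (α : ℝ) :
    knnRate d n ^ (1 + α) =
      Real.log n ^ (α + 1) * (n : ℝ) ^ (-((α + 1) / ((d : ℝ) + 2))) := by
  have hn0 : (0 : ℝ) < n := by exact_mod_cast (by omega : 0 < n)
  have hL := half_le_log hn
  rw [knnRate, Real.mul_rpow (by linarith) (by positivity), ← Real.rpow_mul hn0.le, add_comm 1 α]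
  congr 2
  ring

lemma knnVarianceSupError_congr {d n : ℕ} (k : ℕ) {C : Set (EuclideanSpace ℝ (Fin d))}
    {v w : EuclideanSpace ℝ (Fin d) → ℝ} (h : Set.EqOn v w C) :
    knnVarianceSupError (n := n) k C v = knnVarianceSupError k C w := by
  funext D
  exact iSup_congr fun x => iSup_congr fun hx => by rw [h hx]

lemma IsRegressionFunction.congr {d : ℕ} {ν : Measure (EuclideanSpace ℝ (Fin d) × ℝ)}
    [IsFiniteMeasure ν] {f g : EuclideanSpace ℝ (Fin d) → ℝ} (h : IsRegressionFunction ν f)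
    (hfg : ∀ᵐ x ∂ν.fst, f x = g x) : IsRegressionFunction ν g := by
  filter_upwards [h, hfg] with x hx e
  rwa [← e]

lemma IsConditionalVariance.congr {d : ℕ} {ν : Measure (EuclideanSpace ℝ (Fin d) × ℝ)}
    [IsFiniteMeasure ν] {f g v w : EuclideanSpace ℝ (Fin d) → ℝ} (h : IsConditionalVariance ν f v)
    (hfg : ∀ᵐ x ∂ν.fst, f x = g x) (hvw : ∀ᵐ x ∂ν.fst, v x = w x) :
    IsConditionalVariance ν g w := by
  filter_upwards [h, hfg, hvw] with x hx e e'
  rwa [← e, ← e']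

lemma UniformNoise.congr {d : ℕ} {ν : Measure (EuclideanSpace ℝ (Fin d) × ℝ)}
    [IsFiniteMeasure ν] {f g : EuclideanSpace ℝ (Fin d) → ℝ} {c₀ : ℝ} (h : UniformNoise ν f c₀)
    (hfg : ∀ᵐ x ∂ν.fst, f x = g x) : UniformNoise ν g c₀ := by
  filter_upwards [h, hfg] with x hx e
  rwa [← e]

/-- The error bound of `abs_knnVariance_sub_le` in terms of the rescaled suprema. -/
lemma rescaled_error_le {Lf Lv B δ δmax T₀ T₁ R : ℝ} (hLf : 0 ≤ Lf) (hLv : 0 ≤ Lv) (hB : 0 ≤ B)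
    (hδ : 0 < δ) (hδm : δ ≤ δmax) (hT₀ : 0 ≤ T₀) (hT₁ : 0 ≤ T₁) (hR : 0 ≤ R) :
    T₁ + Lv * R + (T₀ + Lf * R) * (1 + B + T₁) + (T₀ + Lf * R) ^ 2 ≤
      ((1 + Lv) + (1 + Lf) * (1 + B) + ((1 + Lf) + (1 + Lf) ^ 2) * δmax) *
        (δ * (1 + T₀ / δ + T₁ / δ + R / δ) ^ 2) := by
  set s := T₀ / δ + T₁ / δ + R / δ with hs
  have hs0 : 0 ≤ s := by positivity
  have hQ : T₀ + T₁ + R = δ * s := by rw [hs]; field_simp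
  have hΔ : T₀ + Lf * R ≤ (1 + Lf) * (δ * s) := by
    rw [← hQ]
    nlinarith [mul_nonneg hLf hT₀, mul_nonneg hLf hT₁]
  have hΔ0 : 0 ≤ T₀ + Lf * R := by positivity
  have hT₁Q : T₁ ≤ δ * s := by linarith
  have hRQ : R ≤ δ * s := by linarith
  have hδm0 : 0 ≤ δmax := hδ.le.trans hδm
  have h1 : T₁ + Lv * R ≤ (1 + Lv) * (δ * s) := by nlinarith
  have h2 : (T₀ + Lf * R) * (1 + B + T₁) ≤ ((1 + Lf) * (δ * s)) * (1 + B + δ * s) := by gcongr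
  have h3 : (T₀ + Lf * R) ^ 2 ≤ ((1 + Lf) * (δ * s)) ^ 2 := by gcongr
  have e : 1 + T₀ / δ + T₁ / δ + R / δ = 1 + s := by rw [hs]; ring
  have hs1 : s ≤ (1 + s) ^ 2 := by nlinarith
  have hs2 : s ^ 2 ≤ (1 + s) ^ 2 := by nlinarith
  have h4 : δ * s ≤ δ * (1 + s) ^ 2 := by gcongr
  -- The quadratic terms carry δ²; one factor δ is absorbed by its upper bound `δmax`.
  have h5 : (δ * s) ^ 2 ≤ δmax * (δ * (1 + s) ^ 2) := by
    calc (δ * s) ^ 2 = δ * (δ * s ^ 2) := by ring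
      _ ≤ δmax * (δ * (1 + s) ^ 2) := by gcongr
  rw [e]
  calc _ ≤ ((1 + Lv) + (1 + Lf) * (1 + B)) * (δ * s) +
        ((1 + Lf) + (1 + Lf) ^ 2) * (δ * s) ^ 2 := by linarith
    _ ≤ ((1 + Lv) + (1 + Lf) * (1 + B)) * (δ * (1 + s) ^ 2) +
        ((1 + Lf) + (1 + Lf) ^ 2) * (δmax * (δ * (1 + s) ^ 2)) := by gcongr
    _ = _ := by ring

/-- The error is at most a constant times δu² with u ≥ 1, so the real exponent 2(1 + α) can be
raised to a natural number N, for which the moment bounds are available. -/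
lemma knnVarianceSupError_rpow_le {d n k : ℕ} (hn : 2 ≤ n) (hk : 1 ≤ k) (hkn : k ≤ n)
    {C : Set (EuclideanSpace ℝ (Fin d))} {f v : EuclideanSpace ℝ (Fin d) → ℝ} {Lf Lv : NNReal}
    (hf : LipschitzWith Lf f) (hv : LipschitzWith Lv v) {B : ℝ} (hB0 : 0 ≤ B)
    (hB : ∀ x ∈ C, |v x| ≤ B)
    (D : Fin n → EuclideanSpace ℝ (Fin d) × ℝ) (hD : ∀ i, (D i).1 ∈ C) {R : ℝ} (hR0 : 0 ≤ R)
    (hR : ∀ x ∈ C, ∀ i ∈ nearestSet k (fun j => (D j).1) x, ‖(D i).1 - x‖ ≤ R)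
    {K₀ : ℝ} (hK₀ : K₀ = (1 + Lv) + (1 + Lf) * (1 + B) + ((1 + Lf) + (1 + Lf) ^ 2) * ((d : ℝ) + 2))
    {α : ℝ} (hα : 0 ≤ α) {N : ℕ} (hN : 2 * (1 + α) ≤ N) :
    knnVarianceSupError k C v D ^ (1 + α) ≤
      ENNReal.ofReal (K₀ ^ (1 + α) * knnRate d n ^ (1 + α) * 4 ^ N) *
        (1 + ENNReal.ofReal ((nearestSup k C (fun z => z.2 - f z.1) D / knnRate d n) ^ N) +
          ENNReal.ofReal
            ((nearestSup k C (fun z => (z.2 - f z.1) ^ 2 - v z.1) D / knnRate d n) ^ N) +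
          ENNReal.ofReal ((R / knnRate d n) ^ N)) := by
  have hδ := knnRate_pos (d := d) hn
  set δ := knnRate d n with hδdef
  set T₀ := nearestSup k C (fun z => z.2 - f z.1) D with hT₀def
  set T₁ := nearestSup k C (fun z => (z.2 - f z.1) ^ 2 - v z.1) D with hT₁def
  have hT₀ : 0 ≤ T₀ := nearestSup_nonneg _ _
  have hT₁ : 0 ≤ T₁ := nearestSup_nonneg _ _
  have hK₀0 : 0 ≤ K₀ := by rw [hK₀]; positivity
  have hx : 0 ≤ T₀ / δ := by positivity
  have hy : 0 ≤ T₁ / δ := by positivity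
  have hz : 0 ≤ R / δ := by positivity
  set u := 1 + T₀ / δ + T₁ / δ + R / δ with hu
  have hu1 : 1 ≤ u := by linarith
  have herr : knnVarianceSupError k C v D ≤ ENNReal.ofReal (K₀ * (δ * u ^ 2)) := by
    refine iSup₂_le fun x hxC => ENNReal.ofReal_le_ofReal ?_
    refine (abs_knnVariance_sub_le hk hkn hf hv hB D hD hR hxC).trans ?_
    rw [hK₀]
    exact rescaled_error_le Lf.2 Lv.2 hB0 hδ (knnRate_le hn) hT₀ hT₁ hR0
  calc knnVarianceSupError k C v D ^ (1 + α)
      ≤ ENNReal.ofReal (K₀ * (δ * u ^ 2)) ^ (1 + α) := ENNReal.rpow_le_rpow herr (by linarith)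
    _ = ENNReal.ofReal (K₀ ^ (1 + α) * δ ^ (1 + α) * u ^ (2 * (1 + α))) := by
        rw [ENNReal.ofReal_rpow_of_nonneg (by positivity) (by linarith),
          Real.mul_rpow hK₀0 (by positivity), Real.mul_rpow hδ.le (by positivity),
          ← Real.rpow_natCast u 2, ← Real.rpow_mul (by positivity), mul_assoc]
        norm_num
    _ ≤ ENNReal.ofReal (K₀ ^ (1 + α) * δ ^ (1 + α) *
          (4 ^ N * (1 + (T₀ / δ) ^ N + (T₁ / δ) ^ N + (R / δ) ^ N))) := by
        refine ENNReal.ofReal_le_ofReal ?_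
        gcongr
        calc u ^ (2 * (1 + α)) ≤ u ^ (N : ℝ) := Real.rpow_le_rpow_of_exponent_le hu1 hN
          _ = u ^ N := Real.rpow_natCast u N
          _ ≤ _ := one_add_add_add_pow_le hx hy hz N
    _ = _ := by
        rw [← mul_assoc, ENNReal.ofReal_mul (by positivity),
          ENNReal.ofReal_add (by positivity) (by positivity),
          ENNReal.ofReal_add (by positivity) (by positivity),
          ENNReal.ofReal_add (by positivity) (by positivity), ENNReal.ofReal_one]

lemma exists_lintegral_knnVarianceSupError_le (d : ℕ) (hd : 1 ≤ d)
    (C : Set (EuclideanSpace ℝ (Fin d))) (hC : IsCompact C) (hCreg : IsRegularSet C)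
    (f v : EuclideanSpace ℝ (Fin d) → ℝ) {Lf Lv : NNReal} (hf : LipschitzWith Lf f)
    (hv : LipschitzWith Lv v) {c₀ : ℝ} (hc₀ : 0 < c₀) {μmin : ℝ} (hμmin : 0 < μmin)
    {a b : ℝ} (ha : 0 < a) (hab : a ≤ b) {α : ℝ} (hα : 0 ≤ α) :
    ∃ K : ℝ, 0 < K ∧
      ∀ (ν : Measure (EuclideanSpace ℝ (Fin d) × ℝ)) [IsProbabilityMeasure ν],
        StrongDensity ν.fst C μmin → IsRegressionFunction ν f → IsConditionalVariance ν f v →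
        UniformNoise ν f c₀ →
        ∀ n k : ℕ, 2 ≤ n → k ≤ n →
          a * (n : ℝ) ^ (2 / ((d : ℝ) + 2)) ≤ (k : ℝ) →
          (k : ℝ) ≤ b * (n : ℝ) ^ (2 / ((d : ℝ) + 2)) →
          ∫⁻ D, knnVarianceSupError k C v D ^ (1 + α) ∂Measure.pi (fun _ : Fin n => ν) ≤
            ENNReal.ofReal (K * knnRate d n ^ (1 + α)) := by
  obtain ⟨B, hB⟩ : ∃ B, ∀ x ∈ C, |v x| ≤ B := by
    obtain ⟨B, hB⟩ := hC.exists_bound_of_continuousOn hv.continuous.continuousOn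
    exact ⟨B, fun x hx => by simpa using hB x hx⟩
  -- If C is empty, the bound B may be negative; the maximum with 0 restores the sign.
  replace hB : ∀ x ∈ C, |v x| ≤ max B 0 := fun x hx => (hB x hx).trans (le_max_left _ _)
  have hB0 : 0 ≤ max B 0 := le_max_right _ _
  obtain ⟨N, hN⟩ := exists_nat_ge (2 * (1 + α))
  obtain ⟨K₁, hK₁, h₁⟩ := exists_lintegral_nearestSup_noise_le d ha hc₀ N
  obtain ⟨K₂, hK₂, h₂⟩ := exists_lintegral_nearestSup_sq_noise_le d ha hc₀ hB0 N
  obtain ⟨K₃, hK₃, h₃⟩ := exists_radius_div_rate_le hd hC hCreg hμmin ha hab N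
  set K₀ : ℝ := (1 + Lv) + (1 + Lf) * (1 + max B 0) +
    ((1 + Lf) + (1 + Lf) ^ 2) * ((d : ℝ) + 2) with hK₀
  have hK₀0 : 0 < K₀ := by positivity
  refine ⟨K₀ ^ (1 + α) * 4 ^ N * (1 + K₁ + K₂ + K₃), by positivity, ?_⟩
  intro ν _ hν hreg hvar hnoise n k hn hkn hak hkb
  have hk := one_le_of_mul_rpow_le hn ha hak
  have hδ := knnRate_pos (d := d) hn
  obtain ⟨R, hRm, hR0, hRle, hRint⟩ := h₃ ν hν n k hn hkn hak hkb
  have hae : ∀ᵐ D ∂Measure.pi (fun _ : Fin n => ν), ∀ i, (D i).1 ∈ C := by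
    rw [ae_all_iff]
    intro i
    have h : ∀ᵐ z ∂ν, z.1 ∈ C := by
      have := hν.1
      rw [Measure.fst_apply hC.isClosed.measurableSet.compl] at this
      exact this
    exact (measurePreserving_eval (fun _ : Fin n => ν) i).quasiMeasurePreserving.ae h
  refine (lintegral_mono_ae (hae.mono fun D hD => knnVarianceSupError_rpow_le hn hk hkn hf hv hB0 hB
    D hD (hR0 D) (hRle D hD) hK₀ hα hN)).trans ?_
  have hm₀ := measurable_nearestSup (n := n) k hC (g := fun z => z.2 - f z.1)
    (measurable_snd.sub (hf.continuous.measurable.comp measurable_fst))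
  have hm₁ := measurable_nearestSup (n := n) k hC (g := fun z => (z.2 - f z.1) ^ 2 - v z.1)
    (((measurable_snd.sub (hf.continuous.measurable.comp measurable_fst)).pow_const 2).sub
      (hv.continuous.measurable.comp measurable_fst))
  rw [lintegral_const_mul' _ _ ENNReal.ofReal_ne_top, lintegral_add_right _ (by fun_prop),
    lintegral_add_right _ (by fun_prop), lintegral_add_right _ (by fun_prop), lintegral_const,
    measure_univ, mul_one]
  refine (mul_le_mul_right (add_le_add (add_le_add (add_le_add le_rfl
    (h₁ C hC f hf.continuous.measurable ν hreg hnoise n k hn hkn hak))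
    (h₂ C hC f v hf.continuous.measurable hv.continuous.measurable hB ν hν.1 hvar hnoise n k hn
      hkn hak)) hRint) _).trans (le_of_eq ?_)
  rw [← ENNReal.ofReal_one, ← ENNReal.ofReal_add (by positivity) (by positivity),
    ← ENNReal.ofReal_add (by positivity) (by positivity),
    ← ENNReal.ofReal_add (by positivity) (by positivity), ← ENNReal.ofReal_mul (by positivity)]
  congr 1
  ring

theorem mainTheorem6 (d : ℕ) (hd : 1 ≤ d)
    (C : Set (EuclideanSpace ℝ (Fin d))) (hC : IsCompact C) (hCreg : IsRegularSet C)
    (f v : EuclideanSpace ℝ (Fin d) → ℝ)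
    (hf : ∃ L, LipschitzOnWith L f C) (hv : ∃ L, LipschitzOnWith L v C)
    (c₀ : ℝ) (hc₀ : 0 < c₀) (μmin : ℝ) (hμmin : 0 < μmin)
    (a b : ℝ) (ha : 0 < a) (hab : a ≤ b) (α : ℝ) (hα : 0 ≤ α) :
    ∃ K : ℝ, 0 < K ∧
      ∀ (ν : Measure (EuclideanSpace ℝ (Fin d) × ℝ)) [IsProbabilityMeasure ν],
        StrongDensity ν.fst C μmin → IsRegressionFunction ν f → IsConditionalVariance ν f v →
        UniformNoise ν f c₀ →
        ∀ n k : ℕ, 2 ≤ n → k ≤ n →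
          a * (n : ℝ) ^ (2 / ((d : ℝ) + 2)) ≤ (k : ℝ) →
          (k : ℝ) ≤ b * (n : ℝ) ^ (2 / ((d : ℝ) + 2)) →
          ∀ (Ω : Type*) [MeasurableSpace Ω] (P : Measure Ω) [IsProbabilityMeasure P]
            (Z : Fin n → Ω → EuclideanSpace ℝ (Fin d) × ℝ),
            (∀ i, HasLaw (Z i) ν P) → iIndepFun Z P →
            AEMeasurable (fun ω => knnVarianceSupError k C v (fun i => Z i ω)) P ∧
            ∫⁻ ω, (knnVarianceSupError k C v (fun i => Z i ω)) ^ (1 + α) ∂P ≤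
              ENNReal.ofReal (K * Real.log n ^ (α + 1) *
                (n : ℝ) ^ (-((α + 1) / ((d : ℝ) + 2)))) := by
  obtain ⟨Lf, hf⟩ := hf
  obtain ⟨Lv, hv⟩ := hv
  -- Globally Lipschitz extensions are continuous, hence measurable. The law of X is carried by C,
  -- so the conditional hypotheses pass to them, and the supremum over C is unchanged.
  obtain ⟨f', hf', hff'⟩ := hf.extend_real
  obtain ⟨v', hv', hvv'⟩ := hv.extend_real
  obtain ⟨K, hK, h⟩ := exists_lintegral_knnVarianceSupError_le d hd C hC hCreg f' v' hf' hv' hc₀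
    hμmin ha hab hα
  refine ⟨K, hK, fun ν _ hν hreg hvar hnoise n k hn hkn hak hkb Ω _ P _ Z hZ hind => ?_⟩
  have hC' : ∀ᵐ x ∂ν.fst, x ∈ C := hν.1
  have hfae : ∀ᵐ x ∂ν.fst, f x = f' x := hC'.mono fun x hx => hff' hx
  have hvae : ∀ᵐ x ∂ν.fst, v x = v' x := hC'.mono fun x hx => hvv' hx
  have hlaw : HasLaw (fun ω i => Z i ω) (Measure.pi fun _ : Fin n => ν) P := hind.hasLaw_pi hZ
  have hmeas := measurable_knnVarianceSupError (n := n) k hC hv'.continuous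
  rw [knnVarianceSupError_congr k hvv']
  refine ⟨hmeas.comp_aemeasurable hlaw.aemeasurable, ?_⟩
  rw [mul_assoc, ← knnRate_rpow hn]
  refine le_trans (le_of_eq ?_) (h ν hν (hreg.congr hfae) (hvar.congr hfae hvae)
    (hnoise.congr hfae) n k hn hkn hak hkb)
  exact hlaw.lintegral_comp (f := fun D => knnVarianceSupError k C v' D ^ (1 + α))
    (hmeas.pow_const _).aemeasurable
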